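/- **Theorem (Burkholder–Gundy inequality for free stochastic integrals).** Let $(\mathcal A,\tau,(\mathcal A_t)_{t\ge 0},(S_t)_{t\ge 0})$ be a free Brownian motion: $\mathcal A$ is a von Neumann algebra with a faithful normal tracial state $\tau$, $(\mathcal A_t)_{t\ge0}$ is an increasing family of (unital) von Neumann subalgebras of $\mathcal A$, and $S_t=S_t^*\in\mathcal A_t$ are such that $S_t$ has the semicircle distribution with mean $0$ and variance $t$ for all $t\ge 0$ and, for all $0\le s<t$, the increment $S_t-S_s$ is free from $\mathcal A_s$ and has the semicircle distribution with mean $0$ and variance $t-s$. A simple biprocess is a finite sum $U=\sum_j U^{j}$ of functions $[0,\infty)\to\mathcal A\otimes\mathcal A^{op}$ of the form $$U^{j}_t=A_i\otimes B_i\ \text{ for } t_i\le t<t_{i+1}\ (0\le i<n),\qquad U^{j}_t=0\ \text{ for } t\ge t_n,$$ with $0=t_0<t_1<\dots<t_n<\infty$ and $A_i,B_i\in\mathcal A$ (all depending on $j$); it is adapted if always $A_i,B_i\in\mathcal A_{t_i}$. Its stochastic integral is the sum over $j$ of $\sum_{i=0}^{n-1}A_i(S_{t_{i+1}}-S_{t_i})B_i\in\mathcal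 A$, written $\int U_t\sharp dS_t$, and $$\|U\|_{\mathcal B_\infty}:=\Bigl(\int_0^\infty\|U_t\|^2_{L^\infty(\tau\otimes\tau^{op})}\,dt\Bigr)^{1/2},$$ where $L^\infty(\tau\otimes\tau^{op})$ is the von Neumann algebra tensor product of $\mathcal A$ and $\mathcal A^{op}$, with its operator norm. Let $\mathcal B_\infty$ be the completion of the space of simple biprocesses for this norm and $\mathcal B_\infty^a$ its closed subspace generated by the adapted simple biprocesses. Then: 1. For every simple adapted biprocess $U$, $$\Bigl\|\int U_t\sharp dS_t\Bigr\|\le 2\sqrt2\,\|U\|_{\mathcal B_\infty},$$ where the left-hand side is the operator norm. 2. There is exactly one continuous linear map $I:\mathcal B_\infty^a\to\mathcal A$ with $I(U)=\int U_t\sharp dS_t$ for every simple adapted biprocess $U$. In particular, the stochastic integral of every biprocess in $\mathcal B_\infty^a$ is a bounded operator. -/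

import Mathlib

open MeasureTheory Set TensorProduct
open scoped NNReal ENNReal ComplexOrder

/-! ### Concrete von Neumann algebras as C*-algebras with their usual order -/

namespace VonNeumannAlgebra

variable {H : Type*} [NormedAddCommGroup H] [InnerProductSpace ℂ H] [CompleteSpace H]

instance instSMulMemClassComplex : SMulMemClass (VonNeumannAlgebra H) ℂ (H →L[ℂ] H) where
  smul_mem {A} c _ hx := A.toStarSubalgebra.smul_mem hx c

theorem isClosed_coe (A : VonNeumannAlgebra H) : IsClosed (A : Set (H →L[ℂ] H)) := by
  rw [← A.centralizer_centralizer]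
  exact Set.isClosed_centralizer _

noncomputable instance instCStarAlgebra (A : VonNeumannAlgebra H) : CStarAlgebra A :=
  StarSubalgebra.cstarAlgebra A (h_closed := A.isClosed_coe)

/-- The order that a von Neumann algebra inherits from the bounded operators makes it a star
ordered ring: its nonnegative elements are the sums of elements `s⋆ s` with `s` in the algebra. -/
instance instStarOrderedRing (A : VonNeumannAlgebra H) : StarOrderedRing A := by
  refine StarOrderedRing.of_nonneg_iff' (fun {x y} h z => ?_) (fun x => ⟨fun hx => ?_, ?_⟩)
  · exact add_le_add_right (α := H →L[ℂ] H) (show (x : H →L[ℂ] H) ≤ y from h) z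
  · have hx' : (0 : H →L[ℂ] H) ≤ (x : H →L[ℂ] H) := hx
    have hsa : IsSelfAdjoint x := Subtype.ext (IsSelfAdjoint.of_nonneg hx').star_eq
    have hspec : SpectrumRestricts x ContinuousMap.realToNNReal := by
      rw [SpectrumRestricts.nnreal_iff]
      intro r hr
      refine spectrum_nonneg_of_nonneg (𝕜 := ℝ) hx' ?_
      rw [← spectrum.algebraMap_mem_iff ℂ] at hr ⊢
      have : IsClosed (A.toStarSubalgebra : Set (H →L[ℂ] H)) := A.isClosed_coe
      exact (StarSubalgebra.mem_spectrum_iff A.toStarSubalgebra).1 hr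
    obtain ⟨p, hp, -, hpx⟩ :=
      CFC.exists_sqrt_of_isSelfAdjoint_of_quasispectrumRestricts hsa hspec
    exact ⟨p, by rw [hp.star_eq, hpx]⟩
  · rintro ⟨s, rfl⟩
    exact star_mul_self_nonneg (s : H →L[ℂ] H)

/-- A von Neumann algebra as a unital subalgebra of a larger one `A`
(as the set of elements of `A` that lie in `B`). -/
noncomputable def subalgebraIn (B A : VonNeumannAlgebra H) : Subalgebra ℂ A where
  carrier := {x | (x : H →L[ℂ] H) ∈ B}
  mul_mem' hx hy := mul_mem (S := VonNeumannAlgebra H) hx hy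
  add_mem' hx hy := add_mem (S := VonNeumannAlgebra H) hx hy
  algebraMap_mem' r := B.toStarSubalgebra.algebraMap_mem r

end VonNeumannAlgebra

noncomputable section

namespace FreeStochastic

/-! ### Noncommutative probability -/

section Probability

variable {M : Type*} [Ring M] [Algebra ℂ M]

/-- Freeness of a family of unital subalgebras with respect to a functional `φ`: alternating
products (with at least one factor) of centered elements are centered. -/
def AreFree {ι : Type*} (φ : M → ℂ) (B : ι → Subalgebra ℂ M) : Prop :=
  ∀ (k : ℕ) (j : Fin (k + 1) → ι) (a : Fin (k + 1) → M),
    (∀ i, a i ∈ B (j i)) → (∀ i : Fin k, j i.castSucc ≠ j i.succ) → (∀ i, φ (a i) = 0) →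
      φ (List.ofFn a).prod = 0

/-- The random variable `x` is free from the unital subalgebra `B`: the unital algebra generated
by `x` and `B` are free. -/
def IsFreeFrom (φ : M → ℂ) (x : M) (B : Subalgebra ℂ M) : Prop :=
  AreFree φ ![Algebra.adjoin ℂ {x}, B]

/-- The semicircle distribution with mean `0` and variance `v` (a point mass if `v = 0`). -/
def semicircle (v : ℝ≥0) : Measure ℝ :=
  if v = 0 then Measure.dirac 0
  else volume.withDensity fun x => ENNReal.ofReal (1 / (2 * Real.pi * v) * √(4 * v - x ^ 2))

/-- The random variable `x` has the semicircle distribution with mean `0` and variance `v`: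
its moments are those of that measure. -/
def HasSemicircleLaw (φ : M → ℂ) (x : M) (v : ℝ≥0) : Prop :=
  ∀ n : ℕ, φ (x ^ n) = ((∫ y, y ^ n ∂semicircle v : ℝ) : ℂ)

end Probability

/-! ### Free Brownian motion -/

section FreeBrownianMotion

variable {H : Type*} [NormedAddCommGroup H] [InnerProductSpace ℂ H] [CompleteSpace H]

/-- Normality of a positive functional: it preserves suprema of bounded increasing nets of
self-adjoint elements. -/
def IsNormalFunctional {𝓐 : VonNeumannAlgebra H} (τ : 𝓐 →ₚ[ℂ] ℂ) : Prop :=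
  ∀ (D : Set 𝓐) (a : 𝓐), D.Nonempty → DirectedOn (· ≤ ·) D → (∀ d ∈ D, IsSelfAdjoint d) →
    IsLUB D a → IsLUB ((fun d => (τ d).re) '' D) (τ a).re

/-- A free Brownian motion in the von Neumann algebra `𝓐`: a faithful normal tracial state, an
increasing family of von Neumann subalgebras, and an adapted family of self-adjoint operators with
free increments and semicircular distributions. -/
structure FreeBrownianMotion (𝓐 : VonNeumannAlgebra H) where
  /-- the trace -/
  τ : 𝓐 →ₚ[ℂ] ℂ
  τ_one : τ 1 = 1
  τ_tracial : ∀ a b : 𝓐, τ (a * b) = τ (b * a)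
  τ_faithful : ∀ a : 𝓐, τ (star a * a) = 0 → a = 0
  τ_normal : IsNormalFunctional τ
  /-- the filtration -/
  𝓕 : ℝ≥0 → VonNeumannAlgebra H
  𝓕_le : ∀ t, 𝓕 t ≤ 𝓐
  𝓕_mono : Monotone 𝓕
  /-- the process -/
  S : ℝ≥0 → 𝓐
  S_selfAdjoint : ∀ t, IsSelfAdjoint (S t)
  S_mem : ∀ t, (S t : H →L[ℂ] H) ∈ 𝓕 t
  S_law : ∀ t, HasSemicircleLaw τ (S t) t
  S_free : ∀ s t, s < t → IsFreeFrom τ (S t - S s) ((𝓕 s).subalgebraIn 𝓐)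
  S_increment_law : ∀ s t, s < t → HasSemicircleLaw τ (S t - S s) (t - s)

end FreeBrownianMotion

/-! ### The von Neumann algebra tensor product `L^∞(τ ⊗ τᵒᵖ)` of `M` and its opposite -/

section Tensor

variable {M : Type*} [CStarAlgebra M] [PartialOrder M] [StarOrderedRing M]

/-- The functional `τᵒᵖ` on the opposite algebra. -/
def opFunctional (τ : M →ₚ[ℂ] ℂ) : Mᵐᵒᵖ →ₚ[ℂ] ℂ :=
  PositiveLinearMap.mk₀ (τ.toLinearMap ∘ₗ (MulOpposite.opLinearEquiv ℂ).symm.toLinearMap)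
    fun _ hx => τ.map_nonneg hx

/-- The Hilbert space tensor product `L²(M, τ) ⊗ L²(Mᵒᵖ, τᵒᵖ)`. -/
abbrev L2Tensor (τ : M →ₚ[ℂ] ℂ) : Type _ :=
  UniformSpace.Completion (τ.GNS ⊗[ℂ] (opFunctional τ).GNS)

/-- The operator on `L²(M, τ) ⊗ L²(Mᵒᵖ, τᵒᵖ)` with which `a ⊗ b` acts, through the left regular
(GNS) representations of `M` and of `Mᵒᵖ`. -/
def tmulRep (τ : M →ₚ[ℂ] ℂ) (a : M) (b : Mᵐᵒᵖ) : L2Tensor τ →L[ℂ] L2Tensor τ :=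
  (TensorProduct.mapL (τ.gnsStarAlgHom a) ((opFunctional τ).gnsStarAlgHom b)).completion

theorem tmulRep_coe (τ : M →ₚ[ℂ] ℂ) (a : M) (b : Mᵐᵒᵖ)
    (x : τ.GNS ⊗[ℂ] (opFunctional τ).GNS) :
    tmulRep τ a b (x : L2Tensor τ) =
      ((TensorProduct.mapL (τ.gnsStarAlgHom a) ((opFunctional τ).gnsStarAlgHom b) x :
        τ.GNS ⊗[ℂ] (opFunctional τ).GNS) : L2Tensor τ) := by
  simp [tmulRep]

theorem ext_coe {τ : M →ₚ[ℂ] ℂ} {f g : L2Tensor τ →L[ℂ] L2Tensor τ}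
    (h : ∀ x : τ.GNS ⊗[ℂ] (opFunctional τ).GNS, f (x : L2Tensor τ) = g (x : L2Tensor τ)) :
    f = g := by
  ext x
  induction x using UniformSpace.Completion.induction_on with
  | hp => exact isClosed_eq f.continuous g.continuous
  | ih x => exact h x

/-- The bounded operators on `L²(M, τ) ⊗ L²(Mᵒᵖ, τᵒᵖ)` with the operator norm. For a faithful
normal trace `τ` the von Neumann algebra tensor product `L^∞(τ ⊗ τᵒᵖ)` is the weak closure in it
of the operators by which elements of the algebraic tensor product of `M` and `Mᵒᵖ` act. -/
def TensorOperators (τ : M →ₚ[ℂ] ℂ) : Type _ := L2Tensor τ →L[ℂ] L2Tensor τ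

instance (τ : M →ₚ[ℂ] ℂ) : NormedAddCommGroup (TensorOperators τ) :=
  inferInstanceAs (NormedAddCommGroup (L2Tensor τ →L[ℂ] L2Tensor τ))

instance (τ : M →ₚ[ℂ] ℂ) : NormedSpace ℂ (TensorOperators τ) :=
  inferInstanceAs (NormedSpace ℂ (L2Tensor τ →L[ℂ] L2Tensor τ))

instance (τ : M →ₚ[ℂ] ℂ) : CompleteSpace (TensorOperators τ) :=
  inferInstanceAs (CompleteSpace (L2Tensor τ →L[ℂ] L2Tensor τ))

/-- The linear map on the algebraic tensor product given by `tmulRep`. -/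
def tensorRepAux (τ : M →ₚ[ℂ] ℂ) : M ⊗[ℂ] Mᵐᵒᵖ →ₗ[ℂ] (L2Tensor τ →L[ℂ] L2Tensor τ) :=
  TensorProduct.lift (LinearMap.mk₂ ℂ (tmulRep τ)
    (fun a a' b => ext_coe fun x => by
      simp [tmulRep_coe, TensorProduct.map_add_left, UniformSpace.Completion.coe_add])
    (fun c a b => ext_coe fun x => by
      simp [tmulRep_coe, TensorProduct.map_smul_left, UniformSpace.Completion.coe_smul])
    (fun a b b' => ext_coe fun x => by
      simp [tmulRep_coe, TensorProduct.map_add_right, UniformSpace.Completion.coe_add])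
    (fun c a b => ext_coe fun x => by
      simp [tmulRep_coe, TensorProduct.map_smul_right, UniformSpace.Completion.coe_smul]))

/-- The representation of the algebraic tensor product of `M` and `Mᵒᵖ` on
`L²(M, τ) ⊗ L²(Mᵒᵖ, τᵒᵖ)`, linear and with `a ⊗ b` acting by `tmulRep τ a b`. The norm of an
element of the algebraic tensor product in `L^∞(τ ⊗ τᵒᵖ)` is the norm of its image. -/
def tensorRep (τ : M →ₚ[ℂ] ℂ) : M ⊗[ℂ] Mᵐᵒᵖ →ₗ[ℂ] TensorOperators τ := tensorRepAux τ

theorem tensorRep_tmul (τ : M →ₚ[ℂ] ℂ) (a : M) (b : Mᵐᵒᵖ) :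
    tensorRep τ (a ⊗ₜ[ℂ] b) = (tmulRep τ a b : L2Tensor τ →L[ℂ] L2Tensor τ) := by
  change tensorRepAux τ (a ⊗ₜ[ℂ] b) = _
  simp [tensorRepAux]

end Tensor

/-! ### Simple biprocesses and their integrals -/

section Biprocess

/-- A simple biprocess of the form `U_t = A_t ⊗ B_t`: there are `0 = t_0 < t_1 < ⋯ < t_n` such
that `U_t = A_i ⊗ B_i` for `t_i ≤ t < t_{i+1}` and `U_t = 0` for `t ≥ t_n`. -/
structure ElementaryBiprocess (M : Type*) where
  n : ℕ
  time : Fin (n + 1) → ℝ≥0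
  time_zero : time 0 = 0
  time_strictMono : StrictMono time
  A : Fin n → M
  B : Fin n → M

/-- A simple biprocess: a finite sum of simple biprocesses of the form `A_t ⊗ B_t`, which may
have different time partitions. -/
abbrev SimpleBiprocess (M : Type*) := List (ElementaryBiprocess M)

variable {M : Type*} [Ring M] [Algebra ℂ M]

/-- The value `U_t` in the algebraic tensor product of `M` and `Mᵒᵖ`
(it is `0` at negative times). -/
def ElementaryBiprocess.val (U : ElementaryBiprocess M) (t : ℝ) : M ⊗[ℂ] Mᵐᵒᵖ :=
  ∑ i : Fin U.n, (Ico (U.time i.castSucc : ℝ) (U.time i.succ : ℝ)).indicator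
    (fun _ => U.A i ⊗ₜ[ℂ] MulOpposite.op (U.B i)) t

/-- The integral `∑ A_i (S_{t_{i+1}} - S_{t_i}) B_i` of `A_t ⊗ B_t` against `S`. -/
def ElementaryBiprocess.integral (S : ℝ≥0 → M) (U : ElementaryBiprocess M) : M :=
  ∑ i : Fin U.n, U.A i * (S (U.time i.succ) - S (U.time i.castSucc)) * U.B i

/-- The value `U_t` of a simple biprocess. -/
def SimpleBiprocess.val (U : SimpleBiprocess M) (t : ℝ) : M ⊗[ℂ] Mᵐᵒᵖ :=
  (U.map fun E => E.val t).sum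

/-- The stochastic integral `∫ U_t ♯ dS_t` of a simple biprocess. -/
def SimpleBiprocess.integral (S : ℝ≥0 → M) (U : SimpleBiprocess M) : M :=
  (U.map fun E => E.integral S).sum

/-- Adaptedness to a filtration: on `[t_i, t_{i+1})` the coefficients `A_i` and `B_i` of each
summand belong to the algebra at time `t_i`. -/
def SimpleBiprocess.IsAdapted {H : Type*} [NormedAddCommGroup H] [InnerProductSpace ℂ H]
    [CompleteSpace H] {𝓐 : VonNeumannAlgebra H} (𝓕 : ℝ≥0 → VonNeumannAlgebra H)
    (U : SimpleBiprocess 𝓐) : Prop :=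
  ∀ E ∈ U, ∀ i : Fin E.n, (E.A i : H →L[ℂ] H) ∈ 𝓕 (E.time i.castSucc) ∧
    (E.B i : H →L[ℂ] H) ∈ 𝓕 (E.time i.castSucc)

end Biprocess

/-! ### The space `B_∞` and its subspace generated by adapted biprocesses -/

section BInfty

variable {M : Type*} [CStarAlgebra M] [PartialOrder M] [StarOrderedRing M]

/-- The norm of a simple biprocess in `B_∞`: the square root of `∫ ‖U_t‖² dt`, with the operator
norm of `L^∞(τ ⊗ τᵒᵖ)`. -/
def bNorm (τ : M →ₚ[ℂ] ℂ) (U : SimpleBiprocess M) : ℝ :=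
  √(∫ t in Ici (0 : ℝ), ‖tensorRep τ (U.val t)‖ ^ 2)

theorem memLp_val (τ : M →ₚ[ℂ] ℂ) (U : SimpleBiprocess M) :
    MemLp (fun t => tensorRep τ (U.val t)) 2 (volume.restrict (Ici (0 : ℝ))) := by
  induction U with
  | nil => simp [SimpleBiprocess.val]
  | cons E U ih =>
    have h : (fun t => tensorRep τ (SimpleBiprocess.val (E :: U) t)) =
        (fun t => ∑ i : Fin E.n, (Ico (E.time i.castSucc : ℝ) (E.time i.succ : ℝ)).indicator
          (fun _ => tensorRep τ (E.A i ⊗ₜ[ℂ] MulOpposite.op (E.B i))) t) +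
        fun t => tensorRep τ (SimpleBiprocess.val U t) := by
      funext t
      simp only [SimpleBiprocess.val, List.map_cons, List.sum_cons, map_add, Pi.add_apply,
        ElementaryBiprocess.val, map_sum]
      congr 1
      refine Finset.sum_congr rfl fun i _ => ?_
      by_cases ht : t ∈ Ico (E.time i.castSucc : ℝ) (E.time i.succ : ℝ) <;> simp [ht]
    rw [h]
    refine MemLp.add (memLp_finsetSum _ fun i _ => ?_) ih
    refine memLp_indicator_const 2 measurableSet_Ico _ (Or.inr ?_)
    exact ((Measure.restrict_apply_le _ _).trans_lt (by simp)).ne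

/-- The Banach space `L²([0, ∞); L^∞(τ ⊗ τᵒᵖ))` of Bochner square integrable functions. -/
abbrev BochnerL2 (τ : M →ₚ[ℂ] ℂ) : Type _ :=
  Lp (TensorOperators τ) 2 (volume.restrict (Ici (0 : ℝ)))

/-- A simple biprocess as an element of that Banach space. -/
def toL2 (τ : M →ₚ[ℂ] ℂ) (U : SimpleBiprocess M) : BochnerL2 τ :=
  (memLp_val τ U).toLp _

theorem norm_toL2 (τ : M →ₚ[ℂ] ℂ) (U : SimpleBiprocess M) : ‖toL2 τ U‖ = bNorm τ U := by
  rw [toL2, Lp.norm_toLp, (memLp_val τ U).eLpNorm_eq_integral_rpow_norm (by norm_num) (by norm_num),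
    ENNReal.toReal_ofReal (by positivity), bNorm, Real.sqrt_eq_rpow]
  norm_num

/-- The completion `B_∞` of the space of simple biprocesses for the norm `bNorm`, realized as the
closure of the simple biprocesses in a Banach space whose norm restricts to `bNorm`. -/
def BInfty (τ : M →ₚ[ℂ] ℂ) : Submodule ℂ (BochnerL2 τ) :=
  (Submodule.span ℂ (range (toL2 τ))).topologicalClosure

variable {H : Type*} [NormedAddCommGroup H] [InnerProductSpace ℂ H] [CompleteSpace H]
  {𝓐 : VonNeumannAlgebra H}

/-- The closed subspace of `B_∞` generated by the adapted simple biprocesses. -/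
def BInftyAdapted (W : FreeBrownianMotion 𝓐) : Submodule ℂ (BochnerL2 W.τ) :=
  (Submodule.span ℂ {x | ∃ U : SimpleBiprocess 𝓐,
    U.IsAdapted W.𝓕 ∧ toL2 W.τ U = x}).topologicalClosure

theorem BInftyAdapted_le (W : FreeBrownianMotion 𝓐) : BInftyAdapted W ≤ BInfty W.τ :=
  Submodule.topologicalClosure_mono (Submodule.span_mono fun _ ⟨U, _, h⟩ => ⟨U, h⟩)

/-- The class in the adapted subspace of `B_∞` of an adapted simple biprocess. -/
def toBInftyAdapted (W : FreeBrownianMotion 𝓐) (U : SimpleBiprocess 𝓐) (hU : U.IsAdapted W.𝓕) :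
    BInftyAdapted W :=
  ⟨toL2 W.τ U, Submodule.le_topologicalClosure _ (Submodule.subset_span ⟨U, hU, rfl⟩)⟩

end BInfty

end FreeStochastic

end

/-!
The proof compares the even moments of a stochastic integral with those of a semicircular element,
by a form of Itô's formula that only sees traces.

For an adapted simple biprocess `U` let `X_t` be its integral up to time `t`, let
`f_m(t) = τ((X_t⋆ X_t)^m)` and `c(t) = ∫₀ᵗ ‖U_r‖² dr`. Just after a time `x` the process moves by
`X_z - X_x = ∑ aₖ s bₖ`, where `∑ aₖ ⊗ bₖ = U_x` and `s = S_z - S_x` is free from the algebra at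
time `x`, which contains `X_x`, `aₖ` and `bₖ`. Expand the alternating word `(X_z⋆ X_z)^m` to second
order in this increment. The terms of first order have trace zero, and since `‖s‖ ≤ 2 √(z - x)` the
remainder is `O((z - x)^(3/2))`. By freeness a term of second order, in which two letters are
replaced by increments, has trace `(z - x) ∑ᵢⱼ τ(bᵢ w cⱼ) τ(dⱼ w' aᵢ)`, where `w` and `w'` are the
alternating words in `X_x` between the two letters and `∑ cⱼ ⊗ dⱼ` is `∑ aⱼ ⊗ bⱼ` or
`∑ bⱼ⋆ ⊗ aⱼ⋆` (and `∑ aᵢ ⊗ bᵢ` has to be replaced by `∑ bᵢ⋆ ⊗ aᵢ⋆` where the first letter is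
starred); all of these have the norm of `U_x`. Halving `w` and `w'` and applying Cauchy–Schwarz in `L²(τ) ⊗ L²(τᵒᵖ)` bounds it by
`(z - x) ‖U_x‖²` times the `L²(τ)` norms of the four halves (`norm_apply_sharp_mul_sharp_le`).
These norms are square roots of moments, `‖X⋆ X X⋆ ⋯‖₂² = f_k` for a word of length `k`, so that a
pair of letters with an even number of letters between them contributes at most `f_a f_b` with
`a + b = m - 1`, and one with an odd number at most a mean of two such products. Summation over all
pairs (`exists_moment_add_sharp_le`) gives for the upper right derivative
`f_m' ≤ 2 m ‖U_t‖² ∑_{a + b = m - 1} f_a f_b`.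

This is the recursion of the Catalan numbers: by induction on `m`, `f_m ≤ C_m (2c)^m ≤ (8c)^m`
(`le_catalan_mul_pow`). As `τ` is faithful the moments determine the norm (`norm_le_of_moment_le`),
whence `‖X_t‖² ≤ 8 c(t)`, which is the asserted bound with constant `2√2`.

The continuous extension is obtained from the graph of the integral: it is a linear subspace of
`BInftyAdapted W × 𝓐`, dense over the first factor, on which the second coordinate is bounded by
`2√2` times the first; in particular the integral depends only on the class in `B_∞`.
-/

open scoped Topology

namespace FreeStochastic

/-! ### Norms from moments -/

section Norm

variable {M : Type*} [CStarAlgebra M] [PartialOrder M] [StarOrderedRing M]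

/-- The moments of a positive element with respect to a faithful positive functional control its
norm: the spectral part of `y` above a level `R' > R` would contribute at least a multiple of
`R' ^ n` to the `n`-th moment. -/
theorem norm_le_of_moment_le (τ : M →ₚ[ℂ] ℂ) (hτ : ∀ a : M, τ (star a * a) = 0 → a = 0)
    {y : M} (hy : 0 ≤ y) {R : ℝ} (hR : 0 ≤ R) (h : ∀ n : ℕ, (τ (y ^ n)).re ≤ R ^ n) :
    ‖y‖ ≤ R := by
  by_contra! hlt
  have hyn : Nontrivial M := by
    refine ⟨y, 0, fun h0 => ?_⟩
    rw [h0, norm_zero] at hlt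
    exact absurd hlt (not_lt.mpr hR)
  obtain ⟨R', hRR', hR'⟩ := exists_between hlt
  have hR'0 : 0 < R' := hR.trans_lt hRR'
  have hspec : ∀ t ∈ spectrum ℝ y, 0 ≤ t ∧ t ≤ ‖y‖ := fun t ht =>
    ⟨spectrum_nonneg_of_nonneg hy ht, (le_abs_self t).trans (spectrum.norm_le_norm_of_mem ht)⟩
  set g : ℝ → ℝ := fun t => max (t - R') 0 with hg
  have hgc : Continuous g := by fun_prop
  have hg0 : ∀ t, 0 ≤ g t := fun t => le_max_right _ _
  have hsa : IsSelfAdjoint y := IsSelfAdjoint.of_nonneg hy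
  set k : M := cfc (fun t => √(g t)) y with hk
  have hkk : star k * k = cfc g y := by
    have hks : star k = k := (cfc_predicate (R := ℝ) (fun t => √(g t)) y).star_eq
    rw [hks, hk, ← cfc_mul (fun t => √(g t)) (fun t => √(g t)) y
      (by fun_prop) (by fun_prop)]
    exact cfc_congr fun t _ => Real.mul_self_sqrt (hg0 t)
  have hle : ∀ n : ℕ, R' ^ n • cfc g y ≤ ‖y‖ • y ^ n := by
    intro n
    rw [← cfc_smul (R' ^ n) g y (by fun_prop), ← cfc_pow_id (R := ℝ) y n hsa,
      ← cfc_smul ‖y‖ (fun t => t ^ n) y (by fun_prop)]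
    refine cfc_mono (fun t ht => ?_) (by fun_prop) (by fun_prop)
    obtain ⟨ht0, ht1⟩ := hspec t ht
    simp only [smul_eq_mul, hg]
    rcases le_total t R' with htR | htR
    · rw [max_eq_right (by linarith), mul_zero]; positivity
    · rw [max_eq_left (by linarith), mul_comm]
      exact mul_le_mul (by linarith) (pow_le_pow_left₀ hR'0.le htR n) (by positivity)
        (norm_nonneg y)
  have hτg : 0 ≤ τ (cfc g y) := by
    rw [← hkk]; exact τ.map_nonneg (star_mul_self_nonneg k)
  have hre : ∀ n : ℕ, (τ (cfc g y)).re ≤ ‖y‖ * (R / R') ^ n := by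
    intro n
    have h1 : τ (R' ^ n • cfc g y) ≤ τ (‖y‖ • y ^ n) := OrderHomClass.mono τ (hle n)
    rw [← Complex.coe_smul, ← Complex.coe_smul, map_smul, map_smul] at h1
    have h2 := (Complex.le_def.mp h1).1
    simp only [smul_eq_mul, Complex.re_ofReal_mul] at h2
    have h3 : R' ^ n * (τ (cfc g y)).re ≤ ‖y‖ * R ^ n :=
      h2.trans (mul_le_mul_of_nonneg_left (h n) (norm_nonneg y))
    rw [div_pow, ← mul_div_assoc, le_div_iff₀ (by positivity), mul_comm]
    exact h3
  have hlim : Filter.Tendsto (fun n : ℕ => ‖y‖ * (R / R') ^ n) Filter.atTop (nhds 0) := by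
    have := (tendsto_pow_atTop_nhds_zero_of_lt_one (div_nonneg hR hR'0.le)
      ((div_lt_one hR'0).mpr hRR')).const_mul ‖y‖
    simpa using this
  have hre0 : (τ (cfc g y)).re ≤ 0 := ge_of_tendsto' hlim hre
  have hz : τ (star k * k) = 0 := by
    rw [hkk]
    have h1 := Complex.nonneg_iff.mp hτg
    exact Complex.ext (le_antisymm hre0 h1.1) h1.2.symm
  have hk0 := hτ k hz
  have hcfc : cfc g y = 0 := by rw [← hkk, hk0]; simp
  have hmem : ‖y‖ ∈ spectrum ℝ y := CStarAlgebra.norm_mem_spectrum_of_nonneg hy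
  have h4 := norm_apply_le_norm_cfc g y hmem (by fun_prop) hsa
  rw [hcfc, norm_zero, norm_le_zero_iff, hg] at h4
  have : ‖y‖ - R' ≤ 0 := by
    have := le_max_left (‖y‖ - R') 0
    simp only at h4
    linarith
  linarith

end Norm

/-! ### Moments of the semicircle distribution -/

section Semicircle

theorem integral_semicircle {v : ℝ≥0} (hv : v ≠ 0) (f : ℝ → ℝ) :
    ∫ y, f y ∂semicircle v =
      ∫ y in (-(2 * √v))..(2 * √v), 1 / (2 * Real.pi * v) * √(4 * v - y ^ 2) * f y := by
  have hs : (0 : ℝ) ≤ √v := Real.sqrt_nonneg _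
  have hss : √(v : ℝ) ^ 2 = v := Real.sq_sqrt v.coe_nonneg
  rw [semicircle, if_neg hv, integral_withDensity_eq_integral_toReal_smul
    (by fun_prop) (by simp), intervalIntegral.integral_of_le (by linarith),
    ← integral_indicator measurableSet_Ioc]
  refine integral_congr_ae ?_
  refine Filter.Eventually.of_forall fun y => ?_
  have h0 : 0 ≤ 1 / (2 * Real.pi * v) * √(4 * v - y ^ 2) := by positivity
  simp only [ENNReal.toReal_ofReal h0, smul_eq_mul]
  by_cases hy : y ∈ Ioc (-(2 * √(v : ℝ))) (2 * √v)
  · rw [indicator_of_mem hy]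
  · rw [indicator_of_notMem hy]
    have : 4 * (v : ℝ) - y ^ 2 ≤ 0 := by
      rw [mem_Ioc, not_and_or, not_lt, not_le] at hy
      rcases hy with hy | hy <;> nlinarith
    rw [Real.sqrt_eq_zero_of_nonpos this]; simp

theorem hasDerivAt_mul_sqrt {c x : ℝ} (hx : 0 < c - x ^ 2) :
    HasDerivAt (fun y => (c - y ^ 2) * √(c - y ^ 2)) (-(3 * x * √(c - x ^ 2))) x := by
  have h1 : HasDerivAt (fun y => c - y ^ 2) (-(2 * x)) x := by
    simpa using (hasDerivAt_pow 2 x).const_sub c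
  have h2 := h1.mul (h1.sqrt hx.ne')
  refine h2.congr_deriv ?_
  have h3 : √(c - x ^ 2) ≠ 0 := (Real.sqrt_pos.mpr hx).ne'
  have h4 : √(c - x ^ 2) ^ 2 = c - x ^ 2 := Real.sq_sqrt hx.le
  field_simp
  rw [h4]
  ring

/-- The integral over `[-2√v, 2√v]` of the derivative of `p y (4v - y²) √(4v - y²)` vanishes. -/
theorem integral_deriv_mul_sqrt {v : ℝ≥0} (p p' : ℝ → ℝ) (hp : ∀ x, HasDerivAt p (p' x) x)
    (hp' : Continuous p') :
    ∫ y in (-(2 * √(v : ℝ)))..(2 * √v), (p' y * ((4 * v - y ^ 2) * √(4 * v - y ^ 2)) +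
      p y * (-(3 * y * √(4 * v - y ^ 2)))) = 0 := by
  have hs : (0 : ℝ) ≤ √v := Real.sqrt_nonneg _
  have hss : √(v : ℝ) ^ 2 = v := Real.sq_sqrt v.coe_nonneg
  have hpc : Continuous p := continuous_iff_continuousAt.mpr fun x => (hp x).continuousAt
  have hd : ∀ x ∈ Ioo (-(2 * √(v : ℝ))) (2 * √v),
      HasDerivAt (fun y => p y * ((4 * v - y ^ 2) * √(4 * v - y ^ 2)))
        (p' x * ((4 * v - x ^ 2) * √(4 * v - x ^ 2)) + p x * (-(3 * x * √(4 * v - x ^ 2)))) x := by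
    intro x hx
    refine (hp x).mul (hasDerivAt_mul_sqrt ?_)
    have h1 := hx.1
    have h2 := hx.2
    nlinarith
  rw [intervalIntegral.integral_eq_sub_of_hasDerivAt_of_le (by linarith) (by fun_prop) hd
    (Continuous.intervalIntegrable (by fun_prop) _ _)]
  have : 4 * (v : ℝ) - (2 * √v) ^ 2 = 0 := by rw [mul_pow, hss]; ring
  simp [this]

theorem integral_id_semicircle (v : ℝ≥0) : ∫ y, y ∂semicircle v = 0 := by
  by_cases hv : v = 0
  · simp [semicircle, hv]
  · rw [integral_semicircle hv]
    have h := integral_deriv_mul_sqrt (v := v) (fun _ => 1) (fun _ => 0)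
      (fun x => hasDerivAt_const x _) continuous_const
    have h2 : ∫ y in (-(2 * √(v : ℝ)))..(2 * √v), 1 / (2 * Real.pi * v) * √(4 * v - y ^ 2) * y =
      ∫ y in (-(2 * √(v : ℝ)))..(2 * √v), (-(1 / (2 * Real.pi * v)) / 3) *
        (0 * ((4 * v - y ^ 2) * √(4 * v - y ^ 2)) + 1 * (-(3 * y * √(4 * v - y ^ 2)))) := by
      congr 1; ext y; ring
    rw [h2, intervalIntegral.integral_const_mul, h, mul_zero]

theorem integral_sq_semicircle (v : ℝ≥0) :
    ∫ y, y ^ 2 ∂semicircle v = v * ∫ _, (1 : ℝ) ∂semicircle v := by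
  by_cases hv : v = 0
  · simp [semicircle, hv]
  · rw [integral_semicircle hv, integral_semicircle hv, ← intervalIntegral.integral_const_mul,
      ← sub_eq_zero, ← intervalIntegral.integral_sub
      (Continuous.intervalIntegrable (by fun_prop) _ _)
      (Continuous.intervalIntegrable (by fun_prop) _ _)]
    have h := integral_deriv_mul_sqrt (v := v) (fun y => y) (fun _ => 1)
      (fun x => hasDerivAt_id x) continuous_const
    have h2 : ∫ y in (-(2 * √(v : ℝ)))..(2 * √v),
        (1 / (2 * Real.pi * v) * √(4 * v - y ^ 2) * y ^ 2 -
          v * (1 / (2 * Real.pi * v) * √(4 * v - y ^ 2) * 1)) =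
      ∫ y in (-(2 * √(v : ℝ)))..(2 * √v), (-(1 / (2 * Real.pi * v)) / 4) *
        (1 * ((4 * v - y ^ 2) * √(4 * v - y ^ 2)) + y * (-(3 * y * √(4 * v - y ^ 2)))) := by
      congr 1; ext y; ring
    rw [h2, intervalIntegral.integral_const_mul, h, mul_zero]

theorem integral_pow_semicircle_le (v : ℝ≥0) (n : ℕ) :
    ∫ y, y ^ (2 * n) ∂semicircle v ≤ (4 * v) ^ n * ∫ _, (1 : ℝ) ∂semicircle v := by
  by_cases hv : v = 0
  · rcases Nat.eq_zero_or_pos n with rfl | hn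
    · simp
    · simp [semicircle, hv, hn.ne']
  · have hs : (0 : ℝ) ≤ √v := Real.sqrt_nonneg _
    have hss : √(v : ℝ) ^ 2 = v := Real.sq_sqrt v.coe_nonneg
    rw [integral_semicircle hv, integral_semicircle hv, ← intervalIntegral.integral_const_mul]
    refine intervalIntegral.integral_mono_on (by linarith)
      (Continuous.intervalIntegrable (by fun_prop) _ _)
      (Continuous.intervalIntegrable (by fun_prop) _ _) fun y hy => ?_
    have h1 : y ^ (2 * n) ≤ (4 * v) ^ n := by
      rw [pow_mul]
      refine pow_le_pow_left₀ (sq_nonneg y) ?_ n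
      nlinarith [hy.1, hy.2]
    have h0 : 0 ≤ 1 / (2 * Real.pi * v) * √(4 * v - y ^ 2) := by positivity
    calc _ ≤ 1 / (2 * Real.pi * v) * √(4 * v - y ^ 2) * (4 * v) ^ n := by gcongr
      _ = _ := by ring

variable {M : Type*} [Ring M] {φ : M → ℂ} {x : M} {v : ℝ≥0}

theorem HasSemicircleLaw.mass (h : HasSemicircleLaw φ x v) (h1 : φ 1 = 1) :
    ∫ _, (1 : ℝ) ∂semicircle v = 1 := by
  have := h 0
  simp only [pow_zero, h1] at this
  exact_mod_cast this.symm

theorem HasSemicircleLaw.apply_self (h : HasSemicircleLaw φ x v) : φ x = 0 := by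
  have := h 1
  simp only [pow_one, integral_id_semicircle] at this
  simpa using this

theorem HasSemicircleLaw.apply_sq (h : HasSemicircleLaw φ x v) (h1 : φ 1 = 1) :
    φ (x * x) = v := by
  have := h 2
  rw [integral_sq_semicircle, h.mass h1, mul_one, sq] at this
  simpa using this

theorem HasSemicircleLaw.re_apply_pow_le (h : HasSemicircleLaw φ x v) (h1 : φ 1 = 1) (n : ℕ) :
    (φ (x ^ (2 * n))).re ≤ (4 * v) ^ n := by
  rw [h, Complex.ofReal_re]
  simpa [h.mass h1] using integral_pow_semicircle_le v n

end Semicircle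

theorem HasSemicircleLaw.norm_le {M : Type*} [CStarAlgebra M] [PartialOrder M] [StarOrderedRing M]
    {τ : M →ₚ[ℂ] ℂ} (hτ1 : τ 1 = 1) (hτ : ∀ a : M, τ (star a * a) = 0 → a = 0) {x : M} {v : ℝ≥0}
    (h : HasSemicircleLaw τ x v) (hx : IsSelfAdjoint x) : ‖x‖ ≤ 2 * √v := by
  have h1 : ‖star x * x‖ ≤ 4 * v := by
    refine norm_le_of_moment_le τ hτ (star_mul_self_nonneg x) (by positivity) fun n => ?_
    rw [hx.star_eq, ← sq, ← pow_mul]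
    exact h.re_apply_pow_le hτ1 n
  rw [CStarRing.norm_star_mul_self, ← sq] at h1
  refine abs_le_of_sq_le_sq' ?_ (by positivity) |>.2
  rw [mul_pow, Real.sq_sqrt v.coe_nonneg]
  linarith

/-! ### Moments of low order under freeness -/

section Freeness

variable {M : Type*} [Ring M] [Algebra ℂ M] {φ : M →ₗ[ℂ] ℂ} {s : M} {B : Subalgebra ℂ M}

theorem IsFreeFrom.apply_mul_eq_zero (h : IsFreeFrom φ s B) (h1 : φ 1 = 1) (hs : φ s = 0)
    {b : M} (hb : b ∈ B) : φ (s * b) = 0 := by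
  have hsm : s ∈ Algebra.adjoin ℂ {s} := Algebra.self_mem_adjoin_singleton ℂ s
  have h0 := h 1 ![0, 1] ![s, b - φ b • 1]
    (by
      intro i
      fin_cases i
      · exact hsm
      · exact sub_mem hb (B.smul_mem B.one_mem _))
    (by intro i; fin_cases i; simp)
    (by intro i; fin_cases i <;> simp [hs, h1])
  simpa [mul_sub, hs] using h0

theorem IsFreeFrom.apply_mul_mul_mul (h : IsFreeFrom φ s B) (h1 : φ 1 = 1) (hs : φ s = 0)
    {b c : M} (hb : b ∈ B) (hc : c ∈ B) :
    φ (s * b * s * c) = φ (s * s) * φ b * φ c := by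
  have hsm : s ∈ Algebra.adjoin ℂ {s} := Algebra.self_mem_adjoin_singleton ℂ s
  have hb0 : b - φ b • 1 ∈ B := sub_mem hb (B.smul_mem B.one_mem _)
  have hc0 : c - φ c • 1 ∈ B := sub_mem hc (B.smul_mem B.one_mem _)
  have hss : s * s - φ (s * s) • 1 ∈ Algebra.adjoin ℂ {s} :=
    sub_mem (mul_mem hsm hsm) (Subalgebra.smul_mem _ (one_mem _) _)
  have e1 := h 3 ![0, 1, 0, 1] ![s, b - φ b • 1, s, c - φ c • 1]
    (by intro i; fin_cases i <;> simp [hsm, hb0, hc0])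
    (by intro i; fin_cases i <;> simp)
    (by intro i; fin_cases i <;> simp [hs, h1])
  have e2 := h 2 ![0, 1, 0] ![s, b - φ b • 1, s]
    (by intro i; fin_cases i <;> simp [hsm, hb0])
    (by intro i; fin_cases i <;> simp)
    (by intro i; fin_cases i <;> simp [hs, h1])
  have e3 := h 1 ![0, 1] ![s * s - φ (s * s) • 1, c - φ c • 1]
    (by
      intro i
      fin_cases i
      · exact hss
      · exact hc0)
    (by intro i; fin_cases i; simp)
    (by intro i; fin_cases i <;> simp [h1])
  simp [mul_sub, sub_mul, mul_assoc, h1] at e1 e2 e3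
  rw [mul_assoc, mul_assoc]
  linear_combination e1 + φ c * e2 + φ b * e3

end Freeness

/-! ### Bounds for the action of the tensor product -/

section TensorBound

variable {M : Type*} [CStarAlgebra M] [PartialOrder M] [StarOrderedRing M]

/-- The vector `x ⊗ y` of `L²(M, τ) ⊗ L²(Mᵒᵖ, τᵒᵖ)`. -/
noncomputable def tvec (τ : M →ₚ[ℂ] ℂ) (x y : M) : L2Tensor τ :=
  (((τ.toPreGNS x : τ.GNS) ⊗ₜ[ℂ]
    ((opFunctional τ).toPreGNS (MulOpposite.op y) : (opFunctional τ).GNS) :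
      τ.GNS ⊗[ℂ] (opFunctional τ).GNS) : L2Tensor τ)

theorem inner_tvec (τ : M →ₚ[ℂ] ℂ) (x y x' y' : M) :
    inner ℂ (tvec τ x y) (tvec τ x' y') = τ (star x * x') * τ (y' * star y) := by
  rw [tvec, tvec, UniformSpace.Completion.inner_coe, TensorProduct.inner_tmul,
    UniformSpace.Completion.inner_coe, UniformSpace.Completion.inner_coe]
  rfl

theorem tmulRep_tvec (τ : M →ₚ[ℂ] ℂ) (a b x y : M) :
    tmulRep τ a (MulOpposite.op b) (tvec τ x y) = tvec τ (a * x) (y * b) := by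
  rw [tvec, tmulRep_coe, tvec]
  congr 1
  simp

/-- The norm of `L²(M, τ)`. -/
noncomputable def l2Norm (τ : M →ₚ[ℂ] ℂ) (x : M) : ℝ := √(τ (star x * x)).re

omit [StarOrderedRing M] in
theorem l2Norm_nonneg (τ : M →ₚ[ℂ] ℂ) (x : M) : 0 ≤ l2Norm τ x := Real.sqrt_nonneg _

omit [StarOrderedRing M] in
theorem l2Norm_star {τ : M →ₚ[ℂ] ℂ} (htr : ∀ a b : M, τ (a * b) = τ (b * a)) (x : M) :
    l2Norm τ (star x) = l2Norm τ x := by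
  rw [l2Norm, l2Norm, star_star, htr]

theorem re_apply_star_mul_self_nonneg (τ : M →ₚ[ℂ] ℂ) (x : M) : 0 ≤ (τ (star x * x)).re :=
  (Complex.nonneg_iff.mp (τ.map_nonneg (star_mul_self_nonneg x))).1

theorem apply_star_mul_self (τ : M →ₚ[ℂ] ℂ) (x : M) :
    τ (star x * x) = ((l2Norm τ x ^ 2 : ℝ) : ℂ) := by
  have h := Complex.nonneg_iff.mp (τ.map_nonneg (star_mul_self_nonneg x))
  rw [l2Norm, Real.sq_sqrt h.1]
  exact Complex.ext rfl h.2.symm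

theorem norm_tvec {τ : M →ₚ[ℂ] ℂ} (htr : ∀ a b : M, τ (a * b) = τ (b * a)) (x y : M) :
    ‖tvec τ x y‖ = l2Norm τ x * l2Norm τ y := by
  have h : ((‖tvec τ x y‖ ^ 2 : ℝ) : ℂ) = ((l2Norm τ x * l2Norm τ y) ^ 2 : ℝ) := by
    have := inner_self_eq_norm_sq_to_K (𝕜 := ℂ) (tvec τ x y)
    rw [inner_tvec, htr y, apply_star_mul_self, apply_star_mul_self] at this
    push_cast at this ⊢
    rw [mul_pow]
    exact this.symm
  have h' := Complex.ofReal_injective h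
  exact (pow_left_inj₀ (norm_nonneg _)
    (mul_nonneg (l2Norm_nonneg τ x) (l2Norm_nonneg τ y)) two_ne_zero).mp h'

variable {ι κ : Type*} [Fintype ι] [Fintype κ]

/-- The conjugate linear flip `x ⊗ y ↦ y⋆ ⊗ x⋆` is isometric. -/
theorem norm_sum_tvec_flip (τ : M →ₚ[ℂ] ℂ) (x y : ι → M) :
    ‖∑ i, tvec τ (star (y i)) (star (x i))‖ = ‖∑ i, tvec τ (x i) (y i)‖ := by
  have h : inner ℂ (∑ i, tvec τ (star (y i)) (star (x i))) (∑ i, tvec τ (star (y i)) (star (x i)))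
      = inner ℂ (∑ i, tvec τ (x i) (y i)) (∑ i, tvec τ (x i) (y i)) := by
    simp only [sum_inner, inner_sum, inner_tvec, star_star]
    rw [Finset.sum_comm]
    refine Finset.sum_congr rfl fun i _ => Finset.sum_congr rfl fun j _ => ?_
    rw [mul_comm]
  rw [inner_self_eq_norm_sq_to_K, inner_self_eq_norm_sq_to_K] at h
  have h' : ‖∑ i, tvec τ (star (y i)) (star (x i))‖ ^ 2 = ‖∑ i, tvec τ (x i) (y i)‖ ^ 2 := by
    exact_mod_cast h
  exact (pow_left_inj₀ (norm_nonneg _) (norm_nonneg _) two_ne_zero).mp h'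

/-- The operator norm of `∑ aᵢ ⊗ bᵢ`, tested on the elementary tensors `x ⊗ y`, is at most `u`. -/
def TensorBound (τ : M →ₚ[ℂ] ℂ) (a b : ι → M) (u : ℝ) : Prop :=
  ∀ x y : M, ‖∑ i, tvec τ (a i * x) (y * b i)‖ ≤ u * ‖tvec τ x y‖

theorem tensorRep_sum_tvec (τ : M →ₚ[ℂ] ℂ) (a b : ι → M) (x y : M) :
    (show L2Tensor τ →L[ℂ] L2Tensor τ from
      tensorRep τ (∑ i, a i ⊗ₜ[ℂ] MulOpposite.op (b i))) (tvec τ x y) =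
      ∑ i, tvec τ (a i * x) (y * b i) := by
  change tensorRepAux τ (∑ i, a i ⊗ₜ[ℂ] MulOpposite.op (b i)) (tvec τ x y) = _
  rw [map_sum, _root_.sum_apply]
  refine Finset.sum_congr rfl fun i _ => ?_
  rw [← tmulRep_tvec]
  congr 1

theorem norm_tensorRep_apply_le (τ : M →ₚ[ℂ] ℂ) (U : M ⊗[ℂ] Mᵐᵒᵖ) (ξ : L2Tensor τ) :
    ‖(show L2Tensor τ →L[ℂ] L2Tensor τ from tensorRep τ U) ξ‖ ≤ ‖tensorRep τ U‖ * ‖ξ‖ :=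
  ContinuousLinearMap.le_opNorm (show L2Tensor τ →L[ℂ] L2Tensor τ from tensorRep τ U) ξ

theorem tensorBound_norm (τ : M →ₚ[ℂ] ℂ) (a b : ι → M) :
    TensorBound τ a b ‖tensorRep τ (∑ i, a i ⊗ₜ[ℂ] MulOpposite.op (b i))‖ := by
  intro x y
  rw [← tensorRep_sum_tvec]
  exact norm_tensorRep_apply_le τ _ _

/-- The bound for the adjoint `∑ aᵢ⋆ ⊗ bᵢ⋆`. -/
theorem tensorBound_norm_star (τ : M →ₚ[ℂ] ℂ) (a b : ι → M) :
    TensorBound τ (fun i => star (a i)) (fun i => star (b i))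
      ‖tensorRep τ (∑ i, a i ⊗ₜ[ℂ] MulOpposite.op (b i))‖ := by
  intro x y
  set T := (show L2Tensor τ →L[ℂ] L2Tensor τ from
      tensorRep τ (∑ i, a i ⊗ₜ[ℂ] MulOpposite.op (b i))) with hT
  set z := ∑ i, tvec τ (star (a i) * x) (y * star (b i)) with hz
  have h : inner ℂ z z = inner ℂ (tvec τ x y) (T z) := by
    have h2 : T z = ∑ i, ∑ j, tvec τ (a j * (star (a i) * x)) (y * star (b i) * b j) := by
      rw [hz, map_sum]
      exact Finset.sum_congr rfl fun i _ => tensorRep_sum_tvec τ a b _ _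
    rw [h2]
    simp only [hz, sum_inner, inner_sum, inner_tvec, star_mul, star_star]
    refine Finset.sum_congr rfl fun i _ => Finset.sum_congr rfl fun j _ => ?_
    simp only [mul_assoc]
  have h3 : ‖z‖ ^ 2 ≤ ‖tvec τ x y‖ * (‖tensorRep τ (∑ i, a i ⊗ₜ[ℂ] MulOpposite.op (b i))‖ * ‖z‖) := by
    calc ‖z‖ ^ 2 = ‖inner ℂ z z‖ := by rw [inner_self_eq_norm_sq_to_K]; simp
      _ ≤ ‖tvec τ x y‖ * ‖T z‖ := by rw [h]; exact norm_inner_le_norm _ _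
      _ ≤ _ := mul_le_mul_of_nonneg_left (norm_tensorRep_apply_le τ _ z) (norm_nonneg _)
  rcases eq_or_lt_of_le (norm_nonneg z) with h0 | h0
  · rw [← h0]; positivity
  · nlinarith

/-- A bound for `∑ aᵢ ⊗ bᵢ` is one for `∑ bᵢ⋆ ⊗ aᵢ⋆`. -/
theorem TensorBound.flip {τ : M →ₚ[ℂ] ℂ} (htr : ∀ a b : M, τ (a * b) = τ (b * a))
    {a b : ι → M} {u : ℝ} (h : TensorBound τ a b u) :
    TensorBound τ (fun i => star (b i)) (fun i => star (a i)) u := by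
  intro x y
  have h1 := h (star y) (star x)
  rw [← norm_sum_tvec_flip τ] at h1
  rw [norm_tvec htr, l2Norm_star htr, l2Norm_star htr, mul_comm (l2Norm τ y)] at h1
  rw [norm_tvec htr]
  simpa using h1

/-- The estimate behind the Itô correction term: Cauchy–Schwarz in `L²(M, τ) ⊗ L²(Mᵒᵖ, τᵒᵖ)`. -/
theorem norm_sum_apply_mul_apply_le {τ : M →ₚ[ℂ] ℂ} (htr : ∀ a b : M, τ (a * b) = τ (b * a))
    {a b : ι → M} {c d : κ → M} {u u' : ℝ} (h : TensorBound τ b a u)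
    (h' : TensorBound τ (fun j => star (c j)) (fun j => star (d j)) u')
    (p₁ p₂ q₁ q₂ : M) :
    ‖∑ i, ∑ j, τ (b i * (p₁ * p₂) * c j) * τ (d j * (q₁ * q₂) * a i)‖ ≤
      u * u' * (l2Norm τ p₁ * l2Norm τ p₂ * (l2Norm τ q₁ * l2Norm τ q₂)) := by
  have e : ∑ i, ∑ j, τ (b i * (p₁ * p₂) * c j) * τ (d j * (q₁ * q₂) * a i) =
      inner ℂ (∑ j, tvec τ (star (c j) * star p₂) (star q₁ * star (d j)))
        (∑ i, tvec τ (b i * p₁) (q₂ * a i)) := by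
    simp only [sum_inner, inner_sum, inner_tvec, star_mul, star_star]
    refine Finset.sum_congr rfl fun i _ => Finset.sum_congr rfl fun j _ => ?_
    congr 1
    · rw [show b i * (p₁ * p₂) * c j = (b i * p₁) * (p₂ * c j) by simp only [mul_assoc], htr]
    · rw [show d j * (q₁ * q₂) * a i = (d j * q₁) * (q₂ * a i) by simp only [mul_assoc], htr]
  rw [e]
  refine (norm_inner_le_norm _ _).trans ?_
  refine (mul_le_mul (h' _ _) (h _ _) (norm_nonneg _) ((norm_nonneg _).trans (h' _ _))).trans ?_
  rw [norm_tvec htr, norm_tvec htr, l2Norm_star htr, l2Norm_star htr]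
  exact le_of_eq (by ring)

/-- The covariance of two increments `∑ aᵢ s bᵢ` and `∑ cⱼ s dⱼ` along a free centered `s`,
inside a trace, is bounded by the tensor norms of the coefficients. -/
theorem norm_apply_sharp_mul_sharp_le {τ : M →ₚ[ℂ] ℂ} (hτ1 : τ 1 = 1)
    (htr : ∀ a b : M, τ (a * b) = τ (b * a)) {B : Subalgebra ℂ M} {s : M}
    (hfree : IsFreeFrom τ s B) (hs : τ s = 0) {δ : ℝ≥0} (hδ : τ (s * s) = δ)
    {a b : ι → M} {c d : κ → M} (ha : ∀ i, a i ∈ B) (hb : ∀ i, b i ∈ B) (hc : ∀ i, c i ∈ B)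
    (hd : ∀ i, d i ∈ B) {u u' : ℝ} (h : TensorBound τ b a u)
    (h' : TensorBound τ (fun j => star (c j)) (fun j => star (d j)) u')
    {p₁ p₂ q₁ q₂ : M} (hp₁ : p₁ ∈ B) (hp₂ : p₂ ∈ B) (hq₁ : q₁ ∈ B) (hq₂ : q₂ ∈ B) :
    ‖τ ((∑ i, a i * s * b i) * (p₁ * p₂) * (∑ j, c j * s * d j) * (q₁ * q₂))‖ ≤
      δ * (u * u' * (l2Norm τ p₁ * l2Norm τ p₂ * (l2Norm τ q₁ * l2Norm τ q₂))) := by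
  have e : τ ((∑ i, a i * s * b i) * (p₁ * p₂) * (∑ j, c j * s * d j) * (q₁ * q₂)) =
      δ * ∑ i, ∑ j, τ (b i * (p₁ * p₂) * c j) * τ (d j * (q₁ * q₂) * a i) := by
    simp only [Finset.sum_mul, Finset.mul_sum, map_sum]
    rw [Finset.sum_comm]
    refine Finset.sum_congr rfl fun i _ => Finset.sum_congr rfl fun j _ => ?_
    have := IsFreeFrom.apply_mul_mul_mul (φ := τ.toLinearMap) hfree hτ1 hs
      (mul_mem (mul_mem (hb i) (mul_mem hp₁ hp₂)) (hc j))
      (mul_mem (mul_mem (hd j) (mul_mem hq₁ hq₂)) (ha i))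
    simp only [PositiveLinearMap.coe_toLinearMap, hδ] at this
    rw [← mul_assoc (δ : ℂ), ← this]
    rw [show a i * s * b i * (p₁ * p₂) * (c j * s * d j) * (q₁ * q₂) =
      a i * (s * (b i * (p₁ * p₂) * c j) * s * (d j * (q₁ * q₂))) by simp only [mul_assoc], htr]
    simp only [mul_assoc]
  rw [e, norm_mul]
  simp only [Complex.norm_real, Real.norm_eq_abs, NNReal.abs_eq]
  exact mul_le_mul_of_nonneg_left (norm_sum_apply_mul_apply_le htr h h' _ _ _ _) δ.coe_nonneg

omit [StarOrderedRing M] in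
theorem apply_mul_sharp_mul_eq_zero {τ : M →ₚ[ℂ] ℂ} (hτ1 : τ 1 = 1)
    (htr : ∀ a b : M, τ (a * b) = τ (b * a)) {B : Subalgebra ℂ M} {s : M}
    (hfree : IsFreeFrom τ s B) (hs : τ s = 0) {a b : ι → M} (ha : ∀ i, a i ∈ B)
    (hb : ∀ i, b i ∈ B) {p q : M} (hp : p ∈ B) (hq : q ∈ B) :
    τ (p * (∑ i, a i * s * b i) * q) = 0 := by
  simp only [Finset.sum_mul, Finset.mul_sum, map_sum]
  refine Finset.sum_eq_zero fun i _ => ?_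
  rw [show p * (a i * s * b i) * q = (p * a i) * (s * (b i * q)) by simp only [mul_assoc], htr]
  have := IsFreeFrom.apply_mul_eq_zero (φ := τ.toLinearMap) hfree hτ1 hs
    (mul_mem (mul_mem (hb i) hq) (mul_mem hp (ha i)))
  simp only [PositiveLinearMap.coe_toLinearMap] at this
  rwa [mul_assoc]

end TensorBound

/-! ### Second order expansion of words -/

section Word

/-- The product `y i * y (i + 1) * ⋯ * y (i + n - 1)`. -/
def word {M : Type*} [Monoid M] (y : ℕ → M) : ℕ → ℕ → M
  | _, 0 => 1
  | i, n + 1 => y i * word y (i + 1) n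

section Ring

variable {M : Type*} [Ring M] (y h : ℕ → M)

/-- The part of first order in `h` of `word (y + h)`. -/
def wordFirst : ℕ → ℕ → M
  | _, 0 => 0
  | i, n + 1 => h i * word y (i + 1) n + y i * wordFirst (i + 1) n

/-- The part of second order in `h` of `word (y + h)`. -/
def wordSecond : ℕ → ℕ → M
  | _, 0 => 0
  | i, n + 1 => h i * wordFirst y h (i + 1) n + y i * wordSecond (i + 1) n

theorem word_add (i a b : ℕ) : word y i (a + b) = word y i a * word y (i + a) b := by
  induction a generalizing i with
  | zero => simp [word]
  | succ a ih =>
    rw [Nat.succ_add, word, word, ih, mul_assoc, show i + 1 + a = i + (a + 1) by ring]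

theorem word_succ_right (i a : ℕ) : word y i (a + 1) = word y i a * y (i + a) := by
  rw [word_add]; simp [word]

theorem word_periodic {y : ℕ → M} (hy : ∀ i, y (i + 2) = y i) (i k n : ℕ) :
    word y (i + 2 * k) n = word y i n := by
  have h2 : ∀ j, y (j + 2 * k) = y j := by
    intro j
    induction k with
    | zero => rfl
    | succ k ih => rw [show j + 2 * (k + 1) = j + 2 * k + 2 by ring, hy, ih]
  induction n generalizing i with
  | zero => rfl
  | succ n ih => rw [word, word, h2, show i + 2 * k + 1 = i + 1 + 2 * k by ring, ih]

theorem word_mem {S : Type*} [SetLike S M] [SubmonoidClass S M] {B : S} {y : ℕ → M}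
    (hy : ∀ i, y i ∈ B) (i n : ℕ) : word y i n ∈ B := by
  induction n generalizing i with
  | zero => exact one_mem B
  | succ n ih => exact mul_mem (hy i) (ih _)

theorem star_word [StarRing M] {y : ℕ → M} (hy : ∀ i, y (i + 2) = y i)
    (hstar : ∀ i, star (y i) = y (i + 1)) (i n : ℕ) :
    star (word y i n) = word y (i + n) n := by
  induction n generalizing i with
  | zero => simp [word]
  | succ n ih =>
    rw [word, star_mul, ih, hstar, show i + 1 + n = i + (n + 1) by ring, word_succ_right]
    congr 1
    have := word_periodic hy (i + 1) n 1
    simp only [word, mul_one] at this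
    rw [show i + (n + 1) + n = i + 1 + 2 * n by ring, this]

end Ring

/-- Taylor's formula of order two for `word`. -/
theorem exists_word_add_bound {M : Type*} [NormedRing M] (y : ℕ → M) (i n : ℕ) :
    ∃ K : ℝ, 0 ≤ K ∧ ∀ (h : ℕ → M) (ε : ℝ), 0 ≤ ε → ε ≤ 1 → (∀ i, ‖h i‖ ≤ ε) →
      ‖word (y + h) i n - word y i n‖ ≤ K * ε ∧
      ‖word (y + h) i n - word y i n - wordFirst y h i n‖ ≤ K * ε ^ 2 ∧
      ‖word (y + h) i n - word y i n - wordFirst y h i n - wordSecond y h i n‖ ≤ K * ε ^ 3 := by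
  induction n generalizing i with
  | zero =>
    refine ⟨0, le_rfl, fun h ε _ _ _ => ?_⟩
    simp [word, wordFirst, wordSecond]
  | succ n ih =>
    obtain ⟨K, hK, H⟩ := ih (i + 1)
    refine ⟨‖word y (i + 1) n‖ + K + ‖y i‖ * K, by positivity, fun h ε h0 h1 hh => ?_⟩
    obtain ⟨H1, H2, H3⟩ := H h ε h0 h1 hh
    have key : ∀ (r r' : M) (e : ℝ), 0 ≤ e → ‖r‖ ≤ (‖word y (i + 1) n‖ + K) * e →
        ‖r'‖ ≤ K * (e * ε) → ‖h i * r + y i * r'‖ ≤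
          (‖word y (i + 1) n‖ + K + ‖y i‖ * K) * (e * ε) := by
      intro r r' e he hr hr'
      calc ‖h i * r + y i * r'‖ ≤ ‖h i‖ * ‖r‖ + ‖y i‖ * ‖r'‖ :=
            (norm_add_le _ _).trans (add_le_add (norm_mul_le _ _) (norm_mul_le _ _))
        _ ≤ ε * ((‖word y (i + 1) n‖ + K) * e) + ‖y i‖ * (K * (e * ε)) := by
            gcongr
            exact hh i
        _ = _ := by ring
    have e1 : ∀ e : ℝ, 0 ≤ e → K * e ≤ (‖word y (i + 1) n‖ + K) * e := fun e he => by
      gcongr; linarith [norm_nonneg (word y (i + 1) n)]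
    refine ⟨?_, ?_, ?_⟩
    · have e : word (y + h) i (n + 1) - word y i (n + 1) =
          h i * word (y + h) (i + 1) n + y i * (word (y + h) (i + 1) n - word y (i + 1) n) := by
        simp only [word, Pi.add_apply]; noncomm_ring
      rw [e, ← one_mul ε]
      refine key _ _ 1 zero_le_one ?_ (by rwa [one_mul])
      calc ‖word (y + h) (i + 1) n‖ =
            ‖word y (i + 1) n + (word (y + h) (i + 1) n - word y (i + 1) n)‖ := by
              congr 1; abel
        _ ≤ ‖word y (i + 1) n‖ + K * ε := (norm_add_le _ _).trans (by gcongr)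
        _ ≤ _ := by nlinarith
    · have e : word (y + h) i (n + 1) - word y i (n + 1) - wordFirst y h i (n + 1) =
          h i * (word (y + h) (i + 1) n - word y (i + 1) n) +
          y i * (word (y + h) (i + 1) n - word y (i + 1) n - wordFirst y h (i + 1) n) := by
        simp only [word, wordFirst, Pi.add_apply]; noncomm_ring
      rw [e, sq]
      exact key _ _ ε h0 (H1.trans (e1 _ h0)) (by rwa [← sq])
    · have e : word (y + h) i (n + 1) - word y i (n + 1) - wordFirst y h i (n + 1) -
          wordSecond y h i (n + 1) =
          h i * (word (y + h) (i + 1) n - word y (i + 1) n - wordFirst y h (i + 1) n) +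
          y i * (word (y + h) (i + 1) n - word y (i + 1) n - wordFirst y h (i + 1) n -
            wordSecond y h (i + 1) n) := by
        simp only [word, wordFirst, wordSecond, Pi.add_apply]; noncomm_ring
      rw [e, pow_succ]
      exact key _ _ (ε ^ 2) (by positivity) (H2.trans (e1 _ (by positivity)))
        (by rwa [← pow_succ])

variable {M : Type*} [Ring M] [Algebra ℂ M] {φ : M →ₗ[ℂ] ℂ} {y h : ℕ → M} {B : Subalgebra ℂ M}

theorem apply_mul_wordFirst_eq_zero (hy : ∀ i, y i ∈ B)
    (h0 : ∀ i, ∀ p ∈ B, ∀ q ∈ B, φ (p * h i * q) = 0) {p : M} (hp : p ∈ B) (i n : ℕ) :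
    φ (p * wordFirst y h i n) = 0 := by
  induction n generalizing i p with
  | zero => simp [wordFirst]
  | succ n ih =>
    rw [wordFirst, mul_add, map_add, ← mul_assoc, ← mul_assoc, ih (mul_mem hp (hy i)),
      h0 i p hp _ (word_mem hy _ _), add_zero]

/-- If a pair of letters `h` at distance `b + 1` in a word of length `N` contributes at most
`β b`, then so does the second order part, summed over all pairs. -/
theorem norm_apply_wordSecond_le {N : ℕ} {β : ℕ → ℝ}
    (H : ∀ i b c, i + 1 + b + 1 + c = N →
      ‖φ (word y 0 i * h i * word y (i + 1) b * h (i + 1 + b) * word y (i + 1 + b + 1) c)‖ ≤ β b) :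
    ‖φ (wordSecond y h 0 N)‖ ≤ ∑ a ∈ Finset.range N, ∑ b ∈ Finset.range (N - 1 - a), β b := by
  have H1 : ∀ n i b, i + 1 + b + n = N →
      ‖φ (word y 0 i * h i * word y (i + 1) b * wordFirst y h (i + 1 + b) n)‖ ≤
        ∑ k ∈ Finset.range n, β (b + k) := by
    intro n
    induction n with
    | zero => intro i b _; simp [wordFirst]
    | succ n ih =>
      intro i b hn
      rw [wordFirst, mul_add, map_add, Finset.sum_range_succ', add_comm]
      refine (norm_add_le _ _).trans (add_le_add ?_ ?_)
      · have h2 := ih i (b + 1) (by omega)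
        rw [word_succ_right] at h2
        simp only [mul_assoc] at h2 ⊢
        refine h2.trans (le_of_eq (Finset.sum_congr rfl fun k _ => by congr 1; ring))
      · have h2 := H i b n (by omega)
        simpa only [mul_assoc, add_zero] using h2
  have H2 : ∀ n i, i + n = N → ‖φ (word y 0 i * wordSecond y h i n)‖ ≤
      ∑ a ∈ Finset.range n, ∑ b ∈ Finset.range (n - 1 - a), β b := by
    intro n
    induction n with
    | zero => intro i _; simp [wordSecond]
    | succ n ih =>
      intro i hn
      rw [wordSecond, mul_add, map_add, Finset.sum_range_succ', add_comm]
      refine (norm_add_le _ _).trans (add_le_add ?_ ?_)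
      · have h2 := ih (i + 1) (by omega)
        rw [word_succ_right, zero_add, mul_assoc] at h2
        refine h2.trans (le_of_eq (Finset.sum_congr rfl fun k _ => ?_))
        rw [show n + 1 - 1 - (k + 1) = n - 1 - k by omega]
      · have h2 := H1 n i 0 (by omega)
        simpa [word, mul_assoc] using h2
  simpa [word] using H2 N 0 (by omega)

end Word

/-! ### The sums over pairs of positions -/

section Sums

theorem two_mul_sum_range_sum_range {g : ℕ → ℝ} (n : ℕ) (hg : ∀ b ≤ n, g (n - b) = g b) :
    2 * ∑ a ∈ Finset.range (n + 2), ∑ b ∈ Finset.range (n + 1 - a), g b =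
      (n + 2) * ∑ b ∈ Finset.range (n + 1), g b := by
  have h1 : ∀ n : ℕ, ∑ a ∈ Finset.range (n + 2), ∑ b ∈ Finset.range (n + 1 - a), g b =
      ∑ b ∈ Finset.range (n + 1), ((n : ℝ) + 1 - b) * g b := by
    intro n
    induction n with
    | zero => simp [Finset.sum_range_succ]
    | succ n ih =>
      rw [Finset.sum_range_succ']
      have : ∀ k, n + 1 + 1 - (k + 1) = n + 1 - k := fun k => by omega
      simp only [this, ih, tsub_zero]
      rw [Finset.sum_range_succ g (n + 1),
        Finset.sum_range_succ (fun b : ℕ => (((n + 1 : ℕ) : ℝ) + 1 - b) * g b) (n + 1),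
        ← add_assoc, ← Finset.sum_add_distrib]
      push_cast
      congr 1
      · exact Finset.sum_congr rfl fun b _ => by ring
      · ring
  have h2 : ∑ b ∈ Finset.range (n + 1), ((n : ℝ) + 1 - b) * g b =
      ∑ b ∈ Finset.range (n + 1), ((b : ℝ) + 1) * g b := by
    rw [← Finset.sum_range_reflect]
    refine Finset.sum_congr rfl fun b hb => ?_
    have hb' : b ≤ n := by rw [Finset.mem_range] at hb; omega
    rw [show n + 1 - 1 - b = n - b by omega, hg b hb', Nat.cast_sub hb']
    ring
  rw [h1, two_mul]
  nth_rewrite 2 [h2]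
  rw [← Finset.sum_add_distrib, Finset.mul_sum]
  exact Finset.sum_congr rfl fun b _ => by ring

theorem sum_range_two_mul_add_one (F : ℕ → ℝ) (n : ℕ) :
    ∑ b ∈ Finset.range (2 * n + 1), F b =
      ∑ a ∈ Finset.range (n + 1), F (2 * a) + ∑ a ∈ Finset.range n, F (2 * a + 1) := by
  induction n with
  | zero => simp
  | succ n ih =>
    rw [show 2 * (n + 1) + 1 = 2 * n + 1 + 1 + 1 by ring, Finset.sum_range_succ,
      Finset.sum_range_succ, ih, Finset.sum_range_succ _ (n + 1), Finset.sum_range_succ _ n,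
      Finset.sum_range_succ (fun a => F (2 * a + 1)) n, show 2 * (n + 1) = 2 * n + 1 + 1 by ring]
    ring

/-- The pairs of letters with an odd number `b` of letters between them contribute no more than
those with an even number: for odd `b` the product of the four values of `g` is at most the mean of
two products that occur for even `b`. -/
theorem sum_half_products_le (g : ℕ → ℝ) (n : ℕ) :
    ∑ b ∈ Finset.range (2 * n + 1), g (b / 2) * g (b - b / 2) *
        (g ((2 * n - b) / 2) * g (2 * n - b - (2 * n - b) / 2)) ≤
      2 * ∑ a ∈ Finset.range (n + 1), g a ^ 2 * g (n - a) ^ 2 := by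
  rw [sum_range_two_mul_add_one, two_mul (Finset.sum _ _)]
  refine add_le_add (le_of_eq (Finset.sum_congr rfl fun a ha => ?_)) ?_
  · rw [show 2 * a / 2 = a by omega, show 2 * a - a = a by omega,
      show (2 * n - 2 * a) / 2 = n - a by omega, show 2 * n - 2 * a - (n - a) = n - a by omega]
    ring
  · have h1 : ∑ a ∈ Finset.range n, g a ^ 2 * g (n - a) ^ 2 ≤
        ∑ a ∈ Finset.range (n + 1), g a ^ 2 * g (n - a) ^ 2 := by
      rw [Finset.sum_range_succ]; nlinarith [sq_nonneg (g n * g (n - n))]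
    have h2 : ∑ a ∈ Finset.range n, g (a + 1) ^ 2 * g (n - (a + 1)) ^ 2 ≤
        ∑ a ∈ Finset.range (n + 1), g a ^ 2 * g (n - a) ^ 2 := by
      rw [Finset.sum_range_succ']; nlinarith [sq_nonneg (g 0 * g (n - 0))]
    have h3 : ∑ a ∈ Finset.range n, g ((2 * a + 1) / 2) * g (2 * a + 1 - (2 * a + 1) / 2) *
        (g ((2 * n - (2 * a + 1)) / 2) *
          g (2 * n - (2 * a + 1) - (2 * n - (2 * a + 1)) / 2)) ≤
        ∑ a ∈ Finset.range n, (g a ^ 2 * g (n - a) ^ 2 / 2 +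
          g (a + 1) ^ 2 * g (n - (a + 1)) ^ 2 / 2) := by
      refine Finset.sum_le_sum fun a ha => ?_
      rw [Finset.mem_range] at ha
      rw [show (2 * a + 1) / 2 = a by omega, show 2 * a + 1 - a = a + 1 by omega,
        show (2 * n - (2 * a + 1)) / 2 = n - (a + 1) by omega,
        show 2 * n - (2 * a + 1) - (n - (a + 1)) = n - a by omega]
      nlinarith [sq_nonneg (g a * g (n - a) - g (a + 1) * g (n - (a + 1)))]
    rw [Finset.sum_add_distrib, ← Finset.sum_div, ← Finset.sum_div] at h3
    linarith

end Sums

/-! ### The Itô estimate for the moments of `star X * X` -/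

section Ito

variable {M : Type*} [CStarAlgebra M]

/-- The alternating sequence `star X, X, star X, X, …`. -/
def alt (X : M) (i : ℕ) : M := if Even i then star X else X

theorem alt_add_two (X : M) (i : ℕ) : alt X (i + 2) = alt X i := by
  simp [alt, Nat.even_add]

theorem star_alt (X : M) (i : ℕ) : star (alt X i) = alt X (i + 1) := by
  by_cases hi : Even i <;> simp [alt, Nat.even_add_one, hi]

theorem alt_add (X Y : M) : alt (X + Y) = alt X + alt Y := by
  funext i
  by_cases hi : Even i <;> simp [alt, hi]

theorem norm_alt (X : M) (i : ℕ) : ‖alt X i‖ = ‖X‖ := by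
  by_cases hi : Even i <;> simp [alt, hi]

theorem word_alt (X : M) (m : ℕ) : word (alt X) 0 (2 * m) = (star X * X) ^ m := by
  induction m with
  | zero => simp [word]
  | succ m ih =>
    rw [pow_succ, ← ih, show 2 * (m + 1) = 2 * m + 2 by ring, word_add]
    simp [word, alt]

variable [PartialOrder M]

/-- The moment of order `m` of `star X * X`. -/
noncomputable def moment (τ : M →ₚ[ℂ] ℂ) (X : M) (m : ℕ) : ℝ := (τ ((star X * X) ^ m)).re

theorem apply_word_alt {τ : M →ₚ[ℂ] ℂ} (htr : ∀ a b : M, τ (a * b) = τ (b * a)) (X : M)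
    (i m : ℕ) : τ (word (alt X) i (2 * m)) = τ ((star X * X) ^ m) := by
  induction i with
  | zero => rw [word_alt]
  | succ i ih =>
    rw [← ih]
    cases m with
    | zero => rfl
    | succ m =>
      rw [show 2 * (m + 1) = 2 * m + 1 + 1 by ring, word_succ_right, word, htr,
        show i + 1 + (2 * m + 1) = i + 2 * (m + 1) by ring]
      congr 2
      simpa [word] using word_periodic (alt_add_two X) i (m + 1) 1

theorem l2Norm_word_alt_sq [StarOrderedRing M] {τ : M →ₚ[ℂ] ℂ}
    (htr : ∀ a b : M, τ (a * b) = τ (b * a))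
    (X : M) (i m : ℕ) : l2Norm τ (word (alt X) i m) ^ 2 = moment τ X m := by
  rw [l2Norm, Real.sq_sqrt (re_apply_star_mul_self_nonneg τ _),
    star_word (alt_add_two X) (star_alt X), moment, ← apply_word_alt htr X (i + m), two_mul,
    word_add, show i + m + m = i + 2 * m by ring, word_periodic (alt_add_two X)]

theorem l2Norm_word_alt [StarOrderedRing M] {τ : M →ₚ[ℂ] ℂ}
    (htr : ∀ a b : M, τ (a * b) = τ (b * a))
    (X : M) (i m : ℕ) : l2Norm τ (word (alt X) i m) = √(moment τ X m) := by
  rw [← l2Norm_word_alt_sq htr X i m, Real.sqrt_sq (l2Norm_nonneg τ _)]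

theorem moment_nonneg [StarOrderedRing M] (τ : M →ₚ[ℂ] ℂ) (X : M) (m : ℕ) :
    0 ≤ moment τ X m := by
  have h : 0 ≤ (star X * X) ^ m := CStarAlgebra.pow_nonneg (star_mul_self_nonneg X) m
  exact (Complex.nonneg_iff.mp (τ.map_nonneg h)).1

variable [StarOrderedRing M] {ι : Type*} [Fintype ι]

/-- The part of second order in `h = ∑ aₖ s bₖ` of the moment of `X + h`. A pair of letters of
`h` at distance `b + 1` splits the cyclic word into two words of lengths `b` and `2n - b`; each is
halved in turn, and the halves are measured in `L²(M, τ)`. -/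
theorem norm_apply_wordSecond_alt_le {τ : M →ₚ[ℂ] ℂ} (hτ1 : τ 1 = 1)
    (htr : ∀ a b : M, τ (a * b) = τ (b * a)) {B : Subalgebra ℂ M} {s : M}
    (hfree : IsFreeFrom τ s B) (hs : τ s = 0) {δ : ℝ≥0} (hδ : τ (s * s) = δ)
    (hsa : IsSelfAdjoint s) {X : M} (hX : X ∈ B) (hX' : star X ∈ B) {a b : ι → M}
    (ha : ∀ i, a i ∈ B) (hb : ∀ i, b i ∈ B) (ha' : ∀ i, star (a i) ∈ B)
    (hb' : ∀ i, star (b i) ∈ B) (n : ℕ) :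
    τ (wordFirst (alt X) (alt (∑ k, a k * s * b k)) 0 (2 * (n + 1))) = 0 ∧
    ‖τ (wordSecond (alt X) (alt (∑ k, a k * s * b k)) 0 (2 * (n + 1)))‖ ≤
      δ * (2 * (n + 1) * ‖tensorRep τ (∑ k, a k ⊗ₜ[ℂ] MulOpposite.op (b k))‖ ^ 2 *
        ∑ k ∈ Finset.range (n + 1), moment τ X k * moment τ X (n - k)) := by
  set u := ‖tensorRep τ (∑ k, a k ⊗ₜ[ℂ] MulOpposite.op (b k))‖ with hu
  set h := ∑ k, a k * s * b k with hh
  have hXB : ∀ i, alt X i ∈ B := fun i => by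
    by_cases hi : Even i <;> simp [alt, hi, hX, hX']
  have hT := tensorBound_norm τ a b
  have hT' := tensorBound_norm_star τ a b
  rw [← hu] at hT hT'
  have hTf : TensorBound τ b a u := by simpa using hT'.flip htr
  -- the letter `alt h i` is again of the form `∑ Aₖ s Bₖ`, with the same tensor bounds
  have hcoef : ∀ i, ∃ A C : ι → M, (∀ k, A k ∈ B) ∧ (∀ k, C k ∈ B) ∧
      alt h i = ∑ k, A k * s * C k ∧ TensorBound τ C A u ∧
      TensorBound τ (fun k => star (A k)) (fun k => star (C k)) u := by
    intro i
    by_cases hi : Even i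
    · refine ⟨fun k => star (b k), fun k => star (a k), hb', ha', ?_, hT', by simpa using hTf⟩
      simp [alt, hi, hh, star_sum, star_mul, hsa.star_eq, mul_assoc]
    · exact ⟨a, b, ha, hb, by simp [alt, hi, hh], hTf, hT'⟩
  constructor
  · have := apply_mul_wordFirst_eq_zero (φ := τ.toLinearMap) (y := alt X) (h := alt h) hXB
      (fun i p hp q hq => by
        obtain ⟨A, C, hA, hC, e, -, -⟩ := hcoef i
        rw [e]
        exact apply_mul_sharp_mul_eq_zero hτ1 htr hfree hs hA hC hp hq) (one_mem B) 0 (2 * (n + 1))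
    simpa using this
  · set g : ℕ → ℝ := fun k => √(moment τ X k) with hg
    set β : ℕ → ℝ := fun b => δ * (u * u * (g (b / 2) * g (b - b / 2) *
      (g ((2 * n - b) / 2) * g (2 * n - b - (2 * n - b) / 2)))) with hβ
    have H := norm_apply_wordSecond_le (φ := τ.toLinearMap) (y := alt X) (h := alt h)
      (N := 2 * (n + 1)) (β := β) (fun i k c hN => by
        obtain ⟨A, C, hA, hC, e, hAC, -⟩ := hcoef i
        obtain ⟨A', C', hA', hC', e', -, hAC'⟩ := hcoef (i + 1 + k)
        have e1 : word (alt X) 0 i * alt h i * word (alt X) (i + 1) k * alt h (i + 1 + k) *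
            word (alt X) (i + 1 + k + 1) c = word (alt X) 0 i * (alt h i * word (alt X) (i + 1) k *
              alt h (i + 1 + k) * word (alt X) (i + 1 + k + 1) c) := by simp only [mul_assoc]
        have e2 : word (alt X) (i + 1 + k + 1) c * word (alt X) 0 i =
            word (alt X) (i + 1 + k + 1) (2 * n - k) := by
          rw [show 2 * n - k = c + i by omega, word_add, hN]
          congr 1
          simpa using (word_periodic (alt_add_two X) 0 (n + 1) i).symm
        have e3 : ∀ j l, word (alt X) j l =
            word (alt X) j (l / 2) * word (alt X) (j + l / 2) (l - l / 2) := by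
          intro j l
          rw [← word_add]; congr 1; omega
        rw [e1, PositiveLinearMap.coe_toLinearMap, htr, mul_assoc, e2, e3 (i + 1) k,
          e3 (i + 1 + k + 1), e, e']
        refine (norm_apply_sharp_mul_sharp_le hτ1 htr hfree hs hδ hA hC hA' hC' hAC hAC'
          (word_mem hXB _ _) (word_mem hXB _ _) (word_mem hXB _ _) (word_mem hXB _ _)).trans ?_
        simp only [l2Norm_word_alt htr, hβ, hg]
        exact le_rfl)
    rw [PositiveLinearMap.coe_toLinearMap] at H
    refine H.trans ?_
    have hsym : ∀ b ≤ 2 * n, β (2 * n - b) = β b := by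
      intro b hb
      simp only [hβ]
      rw [show 2 * n - (2 * n - b) = b by omega]
      ring
    have h2 := two_mul_sum_range_sum_range (g := β) (2 * n) hsym
    have h3 := sum_half_products_le g n
    have h4 : ∑ b ∈ Finset.range (2 * n + 1), β b ≤
        δ * (u * u * (2 * ∑ a ∈ Finset.range (n + 1), moment τ X a * moment τ X (n - a))) := by
      simp only [hβ, ← Finset.mul_sum]
      have h5 : ∀ k, g k ^ 2 = moment τ X k := fun k => Real.sq_sqrt (moment_nonneg τ X k)
      simp only [h5] at h3
      gcongr
    rw [show 2 * n + 2 = 2 * (n + 1) by ring] at h2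
    rw [show 2 * (n + 1) - 1 = 2 * n + 1 by omega]
    push_cast at h2
    have h6 : (0 : ℝ) ≤ 2 * n + 2 := by positivity
    nlinarith [mul_le_mul_of_nonneg_left h4 h6]

/-- Itô's formula as an inequality: the moments of `X + ∑ aₖ s bₖ`, for a small `s` which is free
from `X` and the coefficients. The constant `K` depends on neither `s` nor its variance `δ`. -/
theorem exists_moment_add_sharp_le {τ : M →ₚ[ℂ] ℂ} (hτ1 : τ 1 = 1)
    (htr : ∀ a b : M, τ (a * b) = τ (b * a)) {B : Subalgebra ℂ M}
    {X : M} (hX : X ∈ B) (hX' : star X ∈ B) {a b : ι → M}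
    (ha : ∀ i, a i ∈ B) (hb : ∀ i, b i ∈ B) (ha' : ∀ i, star (a i) ∈ B)
    (hb' : ∀ i, star (b i) ∈ B) (n : ℕ) :
    ∃ K C : ℝ, ∀ (s : M) (δ : ℝ≥0), IsFreeFrom τ s B → τ s = 0 → τ (s * s) = δ →
      IsSelfAdjoint s → ‖s‖ ≤ 2 * √δ → C * √δ ≤ 1 →
      moment τ (X + ∑ k, a k * s * b k) (n + 1) ≤ moment τ X (n + 1) +
        δ * (2 * (n + 1) * ‖tensorRep τ (∑ k, a k ⊗ₜ[ℂ] MulOpposite.op (b k))‖ ^ 2 *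
          ∑ k ∈ Finset.range (n + 1), moment τ X k * moment τ X (n - k)) + K * √δ ^ 3 := by
  obtain ⟨K, hK, HK⟩ := exists_word_add_bound (alt X) 0 (2 * (n + 1))
  obtain ⟨D, hD⟩ := τ.exists_norm_apply_le
  set C := ∑ k, ‖a k‖ * 2 * ‖b k‖ with hC
  have hC0 : 0 ≤ C := by positivity
  refine ⟨D * (K * C ^ 3), C, fun s δ hfree hs hδ hsa hsn hsmall => ?_⟩
  obtain ⟨h1, h2⟩ :=
    norm_apply_wordSecond_alt_le hτ1 htr hfree hs hδ hsa hX hX' ha hb ha' hb' n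
  set h := ∑ k, a k * s * b k with hh
  have hn : ‖h‖ ≤ C * √δ := by
    rw [hh, hC, Finset.sum_mul]
    refine (norm_sum_le _ _).trans (Finset.sum_le_sum fun k _ => ?_)
    calc ‖a k * s * b k‖ ≤ ‖a k‖ * ‖s‖ * ‖b k‖ :=
          (norm_mul_le _ _).trans (by gcongr; exact norm_mul_le _ _)
      _ ≤ ‖a k‖ * (2 * √δ) * ‖b k‖ := by gcongr
      _ = _ := by ring
  obtain ⟨-, -, h3⟩ := HK (alt h) (C * √δ) (by positivity) hsmall
    (fun i => by rw [norm_alt]; exact hn)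
  rw [← alt_add, word_alt, word_alt] at h3
  set r := (star (X + h) * (X + h)) ^ (n + 1) - (star X * X) ^ (n + 1) -
    wordFirst (alt X) (alt h) 0 (2 * (n + 1)) - wordSecond (alt X) (alt h) 0 (2 * (n + 1)) with hr
  have e : (star (X + h) * (X + h)) ^ (n + 1) = (star X * X) ^ (n + 1) +
      wordFirst (alt X) (alt h) 0 (2 * (n + 1)) +
      wordSecond (alt X) (alt h) 0 (2 * (n + 1)) + r := by rw [hr]; abel
  have hτr : (τ r).re ≤ D * (K * C ^ 3) * √δ ^ 3 := by
    calc (τ r).re ≤ ‖τ r‖ := Complex.re_le_norm _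
      _ ≤ D * ‖r‖ := hD r
      _ ≤ D * (K * (C * √δ) ^ 3) := by gcongr
      _ = _ := by ring
  rw [moment, e, map_add, map_add, map_add, h1, moment]
  simp only [Complex.add_re, add_zero]
  have h4 := (Complex.re_le_norm _).trans h2
  linarith

end Ito

/-! ### Comparison with the moments of the semicircle distribution -/

section Comparison

open Filter

/-- A sequence of functions whose right upper derivatives satisfy the recursion of the moments of
a semicircular process is bounded by these moments. -/
theorem le_catalan_mul_pow {T : ℝ} {f : ℕ → ℝ → ℝ} {c v : ℝ → ℝ}
    (hf : ∀ m, ContinuousOn (f m) (Icc 0 T)) (hf0 : ∀ m t, 0 ≤ f m t) (hf1 : ∀ t, f 0 t ≤ 1)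
    (hinit : ∀ m, f (m + 1) 0 = 0) (hc0 : c 0 = 0) (hc : ContinuousOn c (Icc 0 T))
    (hc' : ∀ x ∈ Ico 0 T, HasDerivWithinAt c (v x) (Ici x) x) (hv : ∀ x, 0 ≤ v x)
    (bound : ∀ x ∈ Ico 0 T, ∀ n, ∃ K : ℝ, ∀ᶠ z in 𝓝[>] x, f (n + 1) z ≤ f (n + 1) x +
      (z - x) * (2 * (n + 1) * v x * ∑ k ∈ Finset.range (n + 1), f k x * f (n - k) x) +
      K * √(z - x) ^ 3)
    (m : ℕ) : ∀ t ∈ Icc 0 T, f m t ≤ catalan m * (2 * c t) ^ m := by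
  induction m using Nat.strong_induction_on with
  | _ m ih =>
  match m with
  | 0 => intro t _; simpa using hf1 t
  | n + 1 =>
    refine image_le_of_liminf_slope_right_le_deriv_boundary (hf (n + 1)) (by simp [hinit, hc0])
      (B := fun t => catalan (n + 1) * (2 * c t) ^ (n + 1))
      (B' := fun x => catalan (n + 1) * (((n + 1 : ℕ) : ℝ) * (2 * c x) ^ n * (2 * v x)))
      (by fun_prop) (fun x hx => ?_) fun x hx r hr => ?_
    · simpa using (((hc' x hx).const_mul 2).pow (n + 1)).const_mul (catalan (n + 1) : ℝ)
    · obtain ⟨K, hK⟩ := bound x hx n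
      set s := ∑ k ∈ Finset.range (n + 1), f k x * f (n - k) x with hs
      have hle : s ≤ catalan (n + 1) * (2 * c x) ^ n := by
        rw [catalan_succ, Nat.cast_sum, Finset.sum_mul, hs,
          ← Fin.sum_univ_eq_sum_range (fun k => f k x * f (n - k) x) (n + 1)]
        refine Finset.sum_le_sum fun k _ => ?_
        have hk : (k : ℕ) ≤ n := Nat.lt_succ_iff.mp k.2
        have hxI : x ∈ Icc 0 T := ⟨hx.1, hx.2.le⟩
        have h1 := ih k (by omega) x hxI
        have h2 := ih (n - k) (by omega) x hxI
        calc f k x * f (n - k) x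
            ≤ (catalan k * (2 * c x) ^ (k : ℕ)) * (catalan (n - k) * (2 * c x) ^ (n - k)) :=
              mul_le_mul h1 h2 (hf0 _ _) ((hf0 _ _).trans h1)
          _ = catalan k * catalan (n - k) * ((2 * c x) ^ (k : ℕ) * (2 * c x) ^ (n - k)) := by ring
          _ = _ := by rw [← pow_add, Nat.add_sub_cancel' hk]; push_cast; ring
      have hlt : 2 * (n + 1) * v x * s < r := by
        refine lt_of_le_of_lt ?_ hr
        have : 0 ≤ 2 * ((n : ℝ) + 1) * v x := mul_nonneg (by positivity) (hv x)
        refine (mul_le_mul_of_nonneg_left hle this).trans (le_of_eq ?_)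
        push_cast; ring
      have hlim : Tendsto (fun z => 2 * (n + 1) * v x * s + K * √(z - x)) (𝓝[>] x)
          (𝓝 (2 * (n + 1) * v x * s)) := by
        have : Continuous fun z => 2 * (n + 1) * v x * s + K * √(z - x) := by fun_prop
        have h := (this.tendsto x).mono_left (nhdsWithin_le_nhds (s := Ioi x))
        simpa using h
      refine Eventually.frequently ?_
      filter_upwards [hK, hlim.eventually_lt_const hlt, self_mem_nhdsWithin] with z h1 h2 hz
      have hz0 : 0 < z - x := sub_pos.mpr hz
      refine lt_of_le_of_lt ?_ h2
      rw [slope_def_field, div_le_iff₀ hz0]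
      have h3 : √(z - x) ^ 3 = √(z - x) * (z - x) := by
        rw [pow_succ, Real.sq_sqrt hz0.le]; ring
      rw [h3] at h1
      linarith

theorem hasDerivWithinAt_primitive {g : ℝ → ℝ} (hg : IntegrableOn g (Ici 0)) {x : ℝ} (hx : 0 ≤ x)
    (hx' : ∀ᶠ z in 𝓝[>] x, g z = g x) :
    HasDerivWithinAt (fun t => ∫ r in (0 : ℝ)..t, g r) (g x) (Ici x) x := by
  refine intervalIntegral.integral_hasDerivWithinAt_right (t := Ioi x) ?_
    ⟨Ioi x, self_mem_nhdsWithin, ?_⟩ ?_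
  · rw [intervalIntegrable_iff_integrableOn_Ioc_of_le hx]
    exact hg.mono_set fun z hz => hz.1.le
  · exact (hg.mono_set fun z (hz : x < z) => hx.trans hz.le).aestronglyMeasurable
  · exact Tendsto.congr' (hx'.mono fun z hz => hz.symm) tendsto_const_nhds

theorem catalan_le_four_pow (n : ℕ) : catalan n ≤ 4 ^ n := by
  rw [catalan_eq_centralBinom_div]
  refine (Nat.div_le_self _ _).trans ?_
  rw [Nat.centralBinom_eq_two_mul_choose]
  refine (Nat.choose_le_two_pow _ _).trans (le_of_eq ?_)
  rw [pow_mul]; norm_num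

end Comparison

/-! ### The integral of a step biprocess up to time `t` -/

section Step

variable {ι : Type*} [Fintype ι]

/-- The value at time `t` of the biprocess `∑ₖ 1_[pₖ, qₖ) Aₖ ⊗ Bₖ`. -/
noncomputable def stepVal {M : Type*} [Ring M] [Algebra ℂ M] (p q : ι → ℝ≥0) (A B : ι → M)
    (t : ℝ) : M ⊗[ℂ] Mᵐᵒᵖ :=
  ∑ k, (Ico (p k : ℝ) (q k)).indicator (fun _ => A k ⊗ₜ[ℂ] MulOpposite.op (B k)) t

/-- The integral over `[0, t]` of the biprocess `∑ₖ 1_[pₖ, qₖ) Aₖ ⊗ Bₖ`. -/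
def stepIntegral {M : Type*} [Ring M] (S : ℝ≥0 → M) (p q : ι → ℝ≥0) (A B : ι → M) (t : ℝ≥0) : M :=
  ∑ k, A k * (S (min t (q k)) - S (min t (p k))) * B k

theorem stepVal_eq {M : Type*} [Ring M] [Algebra ℂ M] (p q : ι → ℝ≥0) (A B : ι → M) (t : ℝ) :
    stepVal p q A B t = ∑ k, (Ico (p k : ℝ) (q k)).indicator (fun _ => A k) t ⊗ₜ[ℂ]
      MulOpposite.op ((Ico (p k : ℝ) (q k)).indicator (fun _ => B k) t) := by
  refine Finset.sum_congr rfl fun k _ => ?_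
  by_cases ht : t ∈ Ico (p k : ℝ) (q k) <;> simp [ht]

theorem eventually_lt_of_lt (p q : ι → ℝ≥0) (x : ℝ) :
    ∀ᶠ z : ℝ in 𝓝[>] x, ∀ k, (x < p k → z < p k) ∧ (x < q k → z < q k) := by
  refine Filter.eventually_all.mpr fun k => Filter.Eventually.and ?_ ?_
  · by_cases h : x < p k
    · filter_upwards [nhdsWithin_le_nhds (Iio_mem_nhds h)] with z hz _ using hz
    · exact Filter.Eventually.of_forall fun z hz => absurd hz h
  · by_cases h : x < q k
    · filter_upwards [nhdsWithin_le_nhds (Iio_mem_nhds h)] with z hz _ using hz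
    · exact Filter.Eventually.of_forall fun z hz => absurd hz h

theorem stepVal_eventually_eq {M : Type*} [Ring M] [Algebra ℂ M] (p q : ι → ℝ≥0) (A B : ι → M)
    (x : ℝ) : ∀ᶠ z in 𝓝[>] x, stepVal p q A B z = stepVal p q A B x := by
  filter_upwards [eventually_lt_of_lt p q x, self_mem_nhdsWithin] with z hz hxz
  have hxz : x < z := hxz
  refine Finset.sum_congr rfl fun k _ => ?_
  have : z ∈ Ico (p k : ℝ) (q k) ↔ x ∈ Ico (p k : ℝ) (q k) := by
    refine ⟨fun h => ⟨?_, hxz.trans h.2⟩, fun h => ⟨h.1.trans hxz.le, (hz k).2 h.2⟩⟩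
    by_contra hlt
    exact absurd h.1 (not_le.mpr ((hz k).1 (not_le.mp hlt)))
  by_cases hx : x ∈ Ico (p k : ℝ) (q k) <;> simp [this, hx]

theorem stepIntegral_eventually_eq {M : Type*} [Ring M] (S : ℝ≥0 → M) {p q : ι → ℝ≥0}
    (hpq : ∀ k, p k ≤ q k) (A B : ι → M) (x : ℝ≥0) :
    ∀ᶠ z in 𝓝[>] (x : ℝ), stepIntegral S p q A B z.toNNReal = stepIntegral S p q A B x +
      ∑ k, (Ico (p k : ℝ) (q k)).indicator (fun _ => A k) (x : ℝ) * (S z.toNNReal - S x) *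
        (Ico (p k : ℝ) (q k)).indicator (fun _ => B k) (x : ℝ) := by
  filter_upwards [eventually_lt_of_lt p q x, self_mem_nhdsWithin] with z hz hxz
  have hxz : (x : ℝ) < z := hxz
  lift z to ℝ≥0 using x.coe_nonneg.trans hxz.le
  rw [Real.toNNReal_coe]
  rw [NNReal.coe_lt_coe] at hxz
  rw [stepIntegral, stepIntegral, ← Finset.sum_add_distrib]
  refine Finset.sum_congr rfl fun k _ => ?_
  obtain ⟨h1, h2⟩ := hz k
  simp only [NNReal.coe_lt_coe] at h1 h2
  rcases lt_or_ge x (p k) with hxp | hpx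
  · have hxq := hxp.trans_le (hpq k)
    have : (x : ℝ) ∉ Ico (p k : ℝ) (q k) := fun h => absurd h.1 (by simpa using hxp)
    simp [this, min_eq_left hxp.le, min_eq_left hxq.le, min_eq_left (h1 hxp).le,
      min_eq_left (h2 hxq).le]
  · rcases lt_or_ge x (q k) with hxq | hqx
    · have : (x : ℝ) ∈ Ico (p k : ℝ) (q k) := ⟨by simpa using hpx, by simpa using hxq⟩
      simp only [this, indicator_of_mem, min_eq_left hxq.le, min_eq_left (h2 hxq).le,
        min_eq_right hpx, min_eq_right (hpx.trans hxz.le)]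
      rw [← add_mul, ← mul_add]
      congr 2
      abel
    · have : (x : ℝ) ∉ Ico (p k : ℝ) (q k) := fun h => absurd h.2 (by simpa using hqx)
      simp [this, min_eq_right hqx, min_eq_right hpx, min_eq_right (hpx.trans hxz.le),
        min_eq_right (hqx.trans hxz.le)]

end Step

/-! ### Moments and norms of stochastic integrals -/

section Integral

variable {H : Type*} [NormedAddCommGroup H] [InnerProductSpace ℂ H] [CompleteSpace H]
  {𝓐 : VonNeumannAlgebra H} (W : FreeBrownianMotion 𝓐)

namespace FreeBrownianMotion

theorem norm_increment_le {s t : ℝ≥0} (hst : s < t) : ‖W.S t - W.S s‖ ≤ 2 * √((t - s : ℝ≥0) : ℝ) :=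
  (W.S_increment_law s t hst).norm_le W.τ_one W.τ_faithful
    ((W.S_selfAdjoint t).sub (W.S_selfAdjoint s))

theorem continuous_S : Continuous W.S := by
  have h : ∀ s t : ℝ≥0, ‖W.S t - W.S s‖ ≤ 2 * √(dist t s) := by
    intro s t
    rcases lt_trichotomy s t with hst | rfl | hst
    · refine (W.norm_increment_le hst).trans (le_of_eq ?_)
      rw [NNReal.coe_sub hst.le, NNReal.dist_eq, abs_of_nonneg]
      simpa using hst.le
    · simp
    · rw [norm_sub_rev]
      refine (W.norm_increment_le hst).trans (le_of_eq ?_)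
      rw [NNReal.coe_sub hst.le, dist_comm, NNReal.dist_eq, abs_of_nonneg]
      simpa using hst.le
  rw [continuous_iff_continuousAt]
  intro s
  rw [ContinuousAt, tendsto_iff_norm_sub_tendsto_zero]
  refine squeeze_zero (fun _ => norm_nonneg _) (fun t => h s t) ?_
  have : Continuous fun t : ℝ≥0 => 2 * √(dist t s) := by fun_prop
  simpa using this.tendsto s

variable {ι : Type*} [Fintype ι] {p q : ι → ℝ≥0} {A B : ι → 𝓐}

theorem continuous_stepIntegral : Continuous (stepIntegral W.S p q A B) := by
  have := W.continuous_S
  unfold stepIntegral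
  fun_prop

theorem stepIntegral_mem (hA : ∀ k, (A k : H →L[ℂ] H) ∈ W.𝓕 (p k))
    (hB : ∀ k, (B k : H →L[ℂ] H) ∈ W.𝓕 (p k)) (hpq : ∀ k, p k ≤ q k) (t : ℝ≥0) :
    stepIntegral W.S p q A B t ∈ (W.𝓕 t).subalgebraIn 𝓐 := by
  refine sum_mem fun k _ => ?_
  have hS : ∀ r, W.S (min t r) ∈ (W.𝓕 t).subalgebraIn 𝓐 := fun r =>
    W.𝓕_mono (min_le_left t r) (W.S_mem _)
  rcases lt_or_ge t (p k) with h | h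
  · simp [min_eq_left h.le, min_eq_left (h.le.trans (hpq k)), zero_mem]
  · exact mul_mem (mul_mem (show A k ∈ (W.𝓕 t).subalgebraIn 𝓐 from W.𝓕_mono h (hA k))
      (sub_mem (hS _) (hS _))) (show B k ∈ (W.𝓕 t).subalgebraIn 𝓐 from W.𝓕_mono h (hB k))

/-- The moments of the integral up to time `t` are dominated by those of a semicircular element
of variance `2 ∫₀ᵗ ‖U_r‖² dr`. -/
theorem moment_stepIntegral_le (hA : ∀ k, (A k : H →L[ℂ] H) ∈ W.𝓕 (p k))
    (hB : ∀ k, (B k : H →L[ℂ] H) ∈ W.𝓕 (p k)) (hpq : ∀ k, p k ≤ q k)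
    (hint : IntegrableOn (fun t => ‖tensorRep W.τ (stepVal p q A B t)‖ ^ 2) (Ici 0))
    (m : ℕ) (T : ℝ≥0) :
    moment W.τ (stepIntegral W.S p q A B T) m ≤
      catalan m * (2 * ∫ t in (0 : ℝ)..T, ‖tensorRep W.τ (stepVal p q A B t)‖ ^ 2) ^ m := by
  have hτc : Continuous W.τ := by
    obtain ⟨D, hD⟩ := W.τ.exists_norm_apply_le
    exact (W.τ.toLinearMap.mkContinuous D hD).continuous
  have key := le_catalan_mul_pow (T := T)
    (f := fun m t => moment W.τ (stepIntegral W.S p q A B t.toNNReal) m)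
    (c := fun t => ∫ r in (0 : ℝ)..t, ‖tensorRep W.τ (stepVal p q A B r)‖ ^ 2)
    (v := fun t => ‖tensorRep W.τ (stepVal p q A B t)‖ ^ 2)
    (fun m => ?_) (fun m t => moment_nonneg _ _ _) (fun t => ?_) (fun m => ?_) (by simp) ?_
    (fun x hx => hasDerivWithinAt_primitive hint hx.1 ?_) (fun x => by positivity)
    (fun x hx n => ?_) m T ⟨T.coe_nonneg, le_rfl⟩
  · simpa using key
  · have := W.continuous_stepIntegral (p := p) (q := q) (A := A) (B := B)
    unfold moment
    have h2 : Continuous fun t : ℝ => stepIntegral W.S p q A B t.toNNReal :=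
      this.comp continuous_real_toNNReal
    exact (Complex.continuous_re.comp (hτc.comp ((h2.star.mul h2).pow m))).continuousOn
  · simp [moment, W.τ_one]
  · simp [moment, stepIntegral]
  · have hI : IntegrableOn (fun t => ‖tensorRep W.τ (stepVal p q A B t)‖ ^ 2) (uIcc 0 (T : ℝ)) := by
      rw [uIcc_of_le T.coe_nonneg]
      exact hint.mono_set fun z hz => hz.1
    have h := intervalIntegral.continuousOn_primitive_interval hI
    rwa [uIcc_of_le T.coe_nonneg] at h
  · filter_upwards [stepVal_eventually_eq p q A B x] with z hz
    rw [hz]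
  · lift x to ℝ≥0 using hx.1
    have hX := W.stepIntegral_mem hA hB hpq x
    set a : ι → 𝓐 := fun k => (Ico (p k : ℝ) (q k)).indicator (fun _ => A k) (x : ℝ) with ha
    set b : ι → 𝓐 := fun k => (Ico (p k : ℝ) (q k)).indicator (fun _ => B k) (x : ℝ) with hb
    have hmem : ∀ D : ι → 𝓐, (∀ k, (D k : H →L[ℂ] H) ∈ W.𝓕 (p k)) → ∀ k,
        (Ico (p k : ℝ) (q k)).indicator (fun _ => D k) (x : ℝ) ∈ (W.𝓕 x).subalgebraIn 𝓐 := by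
      intro D hD k
      by_cases hk : (x : ℝ) ∈ Ico (p k : ℝ) (q k)
      · rw [indicator_of_mem hk]
        exact W.𝓕_mono (by simpa using hk.1) (hD k)
      · rw [indicator_of_notMem hk]
        exact zero_mem _
    have hstar : ∀ y ∈ (W.𝓕 x).subalgebraIn 𝓐, star y ∈ (W.𝓕 x).subalgebraIn 𝓐 :=
      fun y hy => star_mem (S := VonNeumannAlgebra H) (s := W.𝓕 x) hy
    obtain ⟨K, C, hKC⟩ := exists_moment_add_sharp_le W.τ_one W.τ_tracial hX (hstar _ hX)
      (a := a) (b := b) (hmem A hA) (hmem B hB) (fun k => hstar _ (hmem A hA k))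
      (fun k => hstar _ (hmem B hB k)) n
    refine ⟨K, ?_⟩
    have hsmall : ∀ᶠ z in 𝓝[>] (x : ℝ), C * √(z - x) < 1 := by
      have hcont : Continuous fun z : ℝ => C * √(z - x) := by fun_prop
      have h := (hcont.tendsto (x : ℝ)).mono_left (nhdsWithin_le_nhds (s := Ioi (x : ℝ)))
      rw [sub_self, Real.sqrt_zero, mul_zero] at h
      exact h.eventually_lt_const zero_lt_one
    filter_upwards [stepIntegral_eventually_eq W.S hpq A B x, hsmall, self_mem_nhdsWithin]
      with z hz hzs hxz
    have hxz : (x : ℝ) < z := hxz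
    lift z to ℝ≥0 using x.coe_nonneg.trans hxz.le
    rw [NNReal.coe_lt_coe] at hxz
    rw [Real.toNNReal_coe] at hz
    have hlaw := W.S_increment_law x z hxz
    have hδ : ((z - x : ℝ≥0) : ℝ) = (z : ℝ) - x := NNReal.coe_sub hxz.le
    have h := hKC (W.S z - W.S x) (z - x) (W.S_free x z hxz) hlaw.apply_self
      (hlaw.apply_sq W.τ_one) ((W.S_selfAdjoint z).sub (W.S_selfAdjoint x))
      (W.norm_increment_le hxz) (by rw [hδ]; exact hzs.le)
    rw [hδ] at h
    simp only [Real.toNNReal_coe]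
    rw [hz, stepVal_eq]
    exact h

theorem norm_stepIntegral_le (hA : ∀ k, (A k : H →L[ℂ] H) ∈ W.𝓕 (p k))
    (hB : ∀ k, (B k : H →L[ℂ] H) ∈ W.𝓕 (p k)) (hpq : ∀ k, p k ≤ q k)
    (hint : IntegrableOn (fun t => ‖tensorRep W.τ (stepVal p q A B t)‖ ^ 2) (Ici 0)) :
    ‖∑ k, A k * (W.S (q k) - W.S (p k)) * B k‖ ≤
      2 * √2 * √(∫ t in Ici (0 : ℝ), ‖tensorRep W.τ (stepVal p q A B t)‖ ^ 2) := by
  -- `T` is a time after the end of all steps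
  set T : ℝ≥0 := ∑ k, q k with hT
  have hq : ∀ k, q k ≤ T := fun k =>
    Finset.single_le_sum (f := q) (fun _ _ => zero_le) (Finset.mem_univ k)
  have hX : ∑ k, A k * (W.S (q k) - W.S (p k)) * B k = stepIntegral W.S p q A B T := by
    refine Finset.sum_congr rfl fun k _ => ?_
    rw [min_eq_right (hq k), min_eq_right ((hpq k).trans (hq k))]
  rw [hX]
  set X := stepIntegral W.S p q A B T
  set I := ∫ t in Ici (0 : ℝ), ‖tensorRep W.τ (stepVal p q A B t)‖ ^ 2 with hI
  have hI0 : 0 ≤ I := integral_nonneg fun t => by positivity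
  have hle : ∫ t in (0 : ℝ)..T, ‖tensorRep W.τ (stepVal p q A B t)‖ ^ 2 ≤ I := by
    rw [intervalIntegral.integral_of_le T.coe_nonneg]
    exact setIntegral_mono_set hint (Filter.Eventually.of_forall fun t => by positivity)
      (LE.le.eventuallyLE fun t ht => ht.1.le)
  have h0 : 0 ≤ ∫ t in (0 : ℝ)..T, ‖tensorRep W.τ (stepVal p q A B t)‖ ^ 2 :=
    intervalIntegral.integral_nonneg T.coe_nonneg fun t _ => by positivity
  have h : ‖star X * X‖ ≤ 8 * I := by
    refine norm_le_of_moment_le W.τ W.τ_faithful (star_mul_self_nonneg X) (by positivity)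
      fun m => (W.moment_stepIntegral_le hA hB hpq hint m T).trans ?_
    have h4 : (catalan m : ℝ) ≤ 4 ^ m := by exact_mod_cast catalan_le_four_pow m
    calc _ ≤ (4 : ℝ) ^ m * (2 * I) ^ m := by gcongr
      _ = (8 * I) ^ m := by rw [← mul_pow]; ring
  rw [CStarRing.norm_star_mul_self, ← sq] at h
  refine (abs_le_of_sq_le_sq' ?_ (by positivity)).2
  rw [mul_pow, mul_pow, Real.sq_sqrt hI0, Real.sq_sqrt zero_le_two]
  linarith

end FreeBrownianMotion

end Integral

/-! ### Simple biprocesses -/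

section Simple

/-- The intervals of constancy of the summands of a simple biprocess. -/
abbrev SimpleBiprocess.Index {M : Type*} (U : SimpleBiprocess M) : Type :=
  Σ j : Fin U.length, Fin (U.get j).n

theorem sum_map_eq_sum_fin {α N : Type*} [AddCommMonoid N] (l : List α) (f : α → N) :
    (l.map f).sum = ∑ j : Fin l.length, f (l.get j) := by
  rw [← List.sum_ofFn]
  congr 1
  refine List.ext_get (by simp) fun n h1 h2 => by simp

variable {M : Type*} [Ring M] [Algebra ℂ M]

theorem SimpleBiprocess.val_eq (U : SimpleBiprocess M) (t : ℝ) :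
    U.val t = stepVal (fun k : U.Index => (U.get k.1).time k.2.castSucc)
      (fun k => (U.get k.1).time k.2.succ) (fun k => (U.get k.1).A k.2)
      (fun k => (U.get k.1).B k.2) t := by
  rw [SimpleBiprocess.val, sum_map_eq_sum_fin, stepVal, Fintype.sum_sigma]
  rfl

omit [Algebra ℂ M] in
theorem SimpleBiprocess.integral_eq (S : ℝ≥0 → M) (U : SimpleBiprocess M) :
    U.integral S = ∑ k : U.Index, (U.get k.1).A k.2 *
      (S ((U.get k.1).time k.2.succ) - S ((U.get k.1).time k.2.castSucc)) * (U.get k.1).B k.2 := by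
  rw [SimpleBiprocess.integral, sum_map_eq_sum_fin, Fintype.sum_sigma]
  rfl

theorem SimpleBiprocess.val_append (U V : SimpleBiprocess M) (t : ℝ) :
    SimpleBiprocess.val (U ++ V) t = U.val t + V.val t := by
  simp [SimpleBiprocess.val]

omit [Algebra ℂ M] in
theorem SimpleBiprocess.integral_append (S : ℝ≥0 → M) (U V : SimpleBiprocess M) :
    SimpleBiprocess.integral S (U ++ V) = U.integral S + V.integral S := by
  simp [SimpleBiprocess.integral]

/-- The multiple `c • U` of a simple biprocess. -/
def SimpleBiprocess.smul (c : ℂ) (U : SimpleBiprocess M) : SimpleBiprocess M :=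
  U.map fun E => { E with A := fun i => c • E.A i }

theorem SimpleBiprocess.val_smul (c : ℂ) (U : SimpleBiprocess M) (t : ℝ) :
    (U.smul c).val t = c • U.val t := by
  simp only [SimpleBiprocess.val, SimpleBiprocess.smul, List.map_map, List.smul_sum]
  congr 1
  refine List.map_congr_left fun E _ => ?_
  simp only [Function.comp, ElementaryBiprocess.val, Finset.smul_sum]
  refine Finset.sum_congr rfl fun i _ => ?_
  by_cases ht : t ∈ Ico (E.time i.castSucc : ℝ) (E.time i.succ : ℝ) <;>
    simp [ht, TensorProduct.smul_tmul']

theorem SimpleBiprocess.integral_smul (S : ℝ≥0 → M) (c : ℂ) (U : SimpleBiprocess M) :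
    (U.smul c).integral S = c • U.integral S := by
  simp only [SimpleBiprocess.integral, SimpleBiprocess.smul, List.map_map, List.smul_sum]
  congr 1
  refine List.map_congr_left fun E _ => ?_
  simp only [Function.comp, ElementaryBiprocess.integral, Finset.smul_sum, smul_mul_assoc]

end Simple

section L2

variable {M : Type*} [CStarAlgebra M] [PartialOrder M] [StarOrderedRing M] (τ : M →ₚ[ℂ] ℂ)

theorem toL2_nil : toL2 τ [] = 0 := by
  rw [← norm_eq_zero, norm_toL2]
  simp [bNorm, SimpleBiprocess.val]

theorem toL2_append (U V : SimpleBiprocess M) : toL2 τ (U ++ V) = toL2 τ U + toL2 τ V := by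
  rw [toL2, toL2, toL2, ← MemLp.toLp_add]
  refine MemLp.toLp_congr _ _ (Filter.Eventually.of_forall fun t => ?_)
  simp [SimpleBiprocess.val_append]

theorem toL2_smul (c : ℂ) (U : SimpleBiprocess M) : toL2 τ (U.smul c) = c • toL2 τ U := by
  rw [toL2, toL2, ← MemLp.toLp_const_smul]
  refine MemLp.toLp_congr _ _ (Filter.Eventually.of_forall fun t => ?_)
  simp [SimpleBiprocess.val_smul]

end L2

section Adapted

variable {H : Type*} [NormedAddCommGroup H] [InnerProductSpace ℂ H] [CompleteSpace H]
  {𝓐 : VonNeumannAlgebra H}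

theorem SimpleBiprocess.IsAdapted.append {𝓕 : ℝ≥0 → VonNeumannAlgebra H} {U V : SimpleBiprocess 𝓐}
    (hU : U.IsAdapted 𝓕) (hV : V.IsAdapted 𝓕) : SimpleBiprocess.IsAdapted 𝓕 (U ++ V) := by
  intro E hE
  rcases List.mem_append.mp hE with h | h
  · exact hU E h
  · exact hV E h

theorem SimpleBiprocess.IsAdapted.smul {𝓕 : ℝ≥0 → VonNeumannAlgebra H} {U : SimpleBiprocess 𝓐}
    (hU : U.IsAdapted 𝓕) (c : ℂ) : (U.smul c).IsAdapted 𝓕 := by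
  intro E hE i
  obtain ⟨E', hE', rfl⟩ := List.mem_map.mp hE
  exact ⟨SMulMemClass.smul_mem (S := VonNeumannAlgebra H) c (hU E' hE' i).1, (hU E' hE' i).2⟩

namespace FreeBrownianMotion

variable (W : FreeBrownianMotion 𝓐)

theorem norm_integral_le (U : SimpleBiprocess 𝓐) (hU : U.IsAdapted W.𝓕) :
    ‖U.integral W.S‖ ≤ 2 * √2 * bNorm W.τ U := by
  have hint : IntegrableOn (fun t => ‖tensorRep W.τ (U.val t)‖ ^ 2) (Ici 0) := by
    have h := MemLp.integrable_norm_pow (p := 2) (by simpa using memLp_val W.τ U) two_ne_zero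
    simpa only [IntegrableOn] using h
  rw [bNorm, U.integral_eq]
  simp only [U.val_eq] at hint ⊢
  refine W.norm_stepIntegral_le (fun k => ?_) (fun k => ?_) (fun k => ?_) hint
  · exact (hU _ (List.get_mem U k.1) k.2).1
  · exact (hU _ (List.get_mem U k.1) k.2).2
  · exact ((U.get k.1).time_strictMono (Fin.castSucc_lt_succ)).le

/-- The graph of the stochastic integral on adapted simple biprocesses. It is a submodule although
the simple biprocesses, being formal sums, are not a module. -/
def integralGraph : Submodule ℂ (BInftyAdapted W × 𝓐) where
  carrier := {z | ∃ (U : SimpleBiprocess 𝓐) (hU : U.IsAdapted W.𝓕),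
    z = (toBInftyAdapted W U hU, U.integral W.S)}
  zero_mem' := ⟨[], by simp [SimpleBiprocess.IsAdapted], Prod.ext
    (Subtype.ext (toL2_nil W.τ).symm) (by simp [SimpleBiprocess.integral])⟩
  add_mem' := by
    rintro _ _ ⟨U, hU, rfl⟩ ⟨V, hV, rfl⟩
    exact ⟨U ++ V, hU.append hV, Prod.ext (Subtype.ext (toL2_append W.τ U V).symm)
      (SimpleBiprocess.integral_append W.S U V).symm⟩
  smul_mem' := by
    rintro c _ ⟨U, hU, rfl⟩
    exact ⟨U.smul c, hU.smul c, Prod.ext (Subtype.ext (toL2_smul W.τ c U).symm)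
      (U.integral_smul W.S c).symm⟩

/-- The projection of the graph to the adapted subspace of `B_∞`. -/
noncomputable def integralGraphFst : W.integralGraph →ₗ[ℂ] BInftyAdapted W :=
  LinearMap.fst ℂ _ _ ∘ₗ W.integralGraph.subtype

/-- The projection of the graph to the values of the integral. -/
noncomputable def integralGraphSnd : W.integralGraph →ₗ[ℂ] 𝓐 :=
  LinearMap.snd ℂ _ _ ∘ₗ W.integralGraph.subtype

theorem denseRange_integralGraphFst : DenseRange W.integralGraphFst := by
  have hspan : Submodule.span ℂ {x | ∃ U : SimpleBiprocess 𝓐,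
      U.IsAdapted W.𝓕 ∧ toL2 W.τ U = x} ≤
      (LinearMap.range W.integralGraphFst).map (BInftyAdapted W).subtype := by
    rw [Submodule.span_le]
    rintro _ ⟨U, hU, rfl⟩
    exact ⟨toBInftyAdapted W U hU, ⟨⟨_, U, hU, rfl⟩, rfl⟩, rfl⟩
  rw [DenseRange, Subtype.dense_iff]
  intro x hx
  refine closure_mono ?_ hx
  intro y hy
  obtain ⟨w, ⟨g, hg⟩, hw⟩ := hspan hy
  exact ⟨w, ⟨g, hg⟩, hw⟩

theorem norm_integralGraphSnd_le (g : W.integralGraph) :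
    ‖W.integralGraphSnd g‖ ≤ 2 * √2 * ‖W.integralGraphFst g‖ := by
  obtain ⟨_, U, hU, rfl⟩ := g
  refine (W.norm_integral_le U hU).trans (le_of_eq ?_)
  rw [← norm_toL2]
  rfl

end FreeBrownianMotion

end Adapted

end FreeStochastic

theorem theorem3p9 {H : Type*} [NormedAddCommGroup H] [InnerProductSpace ℂ H] [CompleteSpace H]
    (𝓐 : VonNeumannAlgebra H) (W : FreeStochastic.FreeBrownianMotion 𝓐) :
    (∀ U : FreeStochastic.SimpleBiprocess 𝓐, U.IsAdapted W.𝓕 →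
      ‖U.integral W.S‖ ≤ 2 * √2 * FreeStochastic.bNorm W.τ U) ∧
    (∃! I : FreeStochastic.BInftyAdapted W →L[ℂ] 𝓐,
      ∀ (U : FreeStochastic.SimpleBiprocess 𝓐) (hU : U.IsAdapted W.𝓕),
        I (FreeStochastic.toBInftyAdapted W U hU) = U.integral W.S) := by
  refine ⟨W.norm_integral_le, W.integralGraphSnd.extendOfNorm W.integralGraphFst, ?_, ?_⟩
  · intro U hU
    exact LinearMap.extendOfNorm_eq W.denseRange_integralGraphFst
      ⟨_, W.norm_integralGraphSnd_le⟩ ⟨_, U, hU, rfl⟩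
  · intro I hI
    refine (LinearMap.extendOfNorm_unique W.denseRange_integralGraphFst _
      W.norm_integralGraphSnd_le I ?_).symm
    refine LinearMap.ext ?_
    rintro ⟨_, U, hU, rfl⟩
    exact hI U hU
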